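/- **Setting.** Let $\varepsilon>0$, $N\ge 1$, and let $x_1,\dots,x_N\in\mathbb R^d$ be a dataset (repetitions allowed), with mean $\bar x=\frac1N\sum_i x_i$ and $d_{\max}=\max_i\|x_i-\bar x\|$. Put $L=\max\{0,\lceil\log_2(d_{\max}/\varepsilon)\rceil\}$ ($L=0$ if $d_{\max}=0$) and $R_\ell=2^{L-\ell}\varepsilon$ for $0\le\ell\le L$. For a finite tuple $\mathbf z=(z_1,\dots,z_M)$ let $$\mathrm{sep}(\mathbf z)=\min_{i\ne j}\|z_i-z_j\|\quad(=\infty\text{ if }M\le 1),\qquad \mathrm{res}_{\mathbf x}(\mathbf z)=\max_{i\le N}\min_{j\le M}\|x_i-z_j\| .$$ Let $P_r$ be the external packing number at scale $1/2$ of the closed ball $B(r)\subset\mathbb R^d$ of radius $r$, i.e. the largest cardinality of a subset of $B(r)$ whose distinct points are at distance $>1/2$. **Algorithm (cover tree inducing points).** Level $0$ has a single node (the root), located at $\bar x$, to which all data are assigned and whose only $R$-neighbor is itself. For $\ell=1,\dots,L$, level $\ell$ is built from level $\ell-1$: 1. Process the nodes $p$ of level $\ell-1$ one after the other. While data are still assigned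 to $p$: choose an arbitrary data point $\zeta$ assigned to $p$. *Optionally (local averaging)*, let $\zeta'$ be the average of the data currently assigned to $p$ within distance $R_\ell$ of $\zeta$, and replace $\zeta$ by $\zeta'$ if $\zeta'$ has distance $>R_\ell$ from all children created so far of the $R$-neighbors of $p$. Create a level-$\ell$ node at $\zeta$ as a child of $p$, and reassign to it all data within distance $R_\ell$ of $\zeta$ that are currently assigned to $R$-neighbors of $p$. 2. The $R$-neighbors of a level-$\ell$ node $v$ are those children of the $R$-neighbors of the parent of $v$ that lie within distance $4\bigl(1-2^{-(K-\ell)}\bigr)R_\ell$ of $v$, where $K=L+1$ is the number of levels. 3. *Optionally (Voronoi repartitioning)*, replace the data assigned to each level-$\ell$ node $v$ by those data that were assigned, at the beginning of the construction of level $\ell$, to an $R$-neighbor of the parent of $v$ and to which no node is closer than $v$; here the distance from a point to the closest node is computed by searching the children of the $R$-neighbors of the level-$(\ell-1)$ node holding the point. A step is an elementary operation: a distance evaluation, an arithmetic operation on points or numbers, a comparison, the choice of an element of a set, an array access, or the insertion or deletion of an element of a finite set. Counts are up to an absolute constant factor. **Theorem.** There is an absolute constant $C>0$ such that, for all $d$,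 $N$, $\mathbf x$ and $\varepsilon$ as above, with or without each of the two optional parts, and for every sequence of arbitrary choices, the algorithm terminates after at most $$C\,P_4\,P_1^2\,N\,\max\{1,\log(d_{\max}/\varepsilon)\}$$ steps. It produces a rooted tree with $L+1$ nonempty levels $0,1,\dots,L$ (each node other than the root has exactly one parent, a node of the previous level). For every $\ell\in\{0,\dots,L\}$ the tuple $\mathbf z_\ell$ of the locations of the nodes of level $\ell$ satisfies $$\mathrm{res}_{\mathbf x}(\mathbf z_\ell)\le 2^{L-\ell}\varepsilon,\qquad \mathrm{sep}(\mathbf z_\ell)\ge 2^{L-\ell}\varepsilon .$$ -/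

import Mathlib

namespace CoverTree

/-! ### Separation, spatial resolution, packing numbers -/

/-- `sep z = min_{i ≠ j} ‖z i - z j‖`, with value `∞` when there is no pair `i ≠ j`. -/
noncomputable def sep {d M : ℕ} (z : Fin M → EuclideanSpace ℝ (Fin d)) : ENNReal :=
  ⨅ i : Fin M, ⨅ j : Fin M, ⨅ _ : i ≠ j, ENNReal.ofReal ‖z i - z j‖

/-- `res x z = max_i min_j ‖x i - z j‖`, with value `∞` when there is data but no node. -/
noncomputable def res {d N M : ℕ} (x : Fin N → EuclideanSpace ℝ (Fin d))
    (z : Fin M → EuclideanSpace ℝ (Fin d)) : ENNReal :=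
  ⨆ i : Fin N, ⨅ j : Fin M, ENNReal.ofReal ‖x i - z j‖

/-- The external packing number of the closed ball of radius `r` in `ℝ^d` at scale `1/2`:
the largest cardinality of a subset whose distinct points are at distance `> 1/2`. -/
noncomputable def ballPacking (d : ℕ) (r : ℝ) : ℕ :=
  (Metric.packingNumber (1 / 2 : NNReal)
    (Metric.closedBall (0 : EuclideanSpace ℝ (Fin d)) r)).toNat

/-- The mean of the dataset. -/
noncomputable def mean {d N : ℕ} (x : Fin N → EuclideanSpace ℝ (Fin d)) :
    EuclideanSpace ℝ (Fin d) :=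
  (N : ℝ)⁻¹ • ∑ i, x i

/-- `d_max = max_i ‖x i - mean x‖`. -/
noncomputable def dMax {d N : ℕ} (x : Fin N → EuclideanSpace ℝ (Fin d)) : ℝ :=
  ⨆ i, ‖x i - mean x‖

/-- `L = ⌈log₂ (dmax / ε)⌉`, and `0` when this is negative or `dmax = 0`. -/
noncomputable def depth (dmax ε : ℝ) : ℕ := ⌈Real.logb 2 (dmax / ε)⌉₊

/-! ### Programs that count their steps

A program carries a step counter; the value `none` means that it does not terminate.
Computing a distance, an arithmetic operation on points or numbers, a comparison, reading or
writing an array entry, choosing an element of a nonempty set, and inserting an element into a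
finite set or deleting one from it are elementary; each `tick` pays for the boundedly many
elementary operations that the statement or the loop iteration containing it performs outside
its inner loops. -/

abbrev Prog (α : Type) : Type := StateT ℕ Option α

/-- Spend one step. -/
def tick : Prog Unit := modify (· + 1)

/-- `for a in l do body`, acting on a state `s`; every iteration spends one step besides the
steps of the body. -/
def forEach {α σ : Type} (l : List α) (s : σ) (body : σ → α → Prog σ) : Prog σ :=
  l.foldlM (fun s a => do tick; body s a) s

/-- `while cond do body`, stopped without a result when the condition has been tested `n` times
and still holds; every test of the condition spends one step. -/
def whileFuel {σ : Type} (cond : σ → Bool) (body : σ → Prog σ) : ℕ → σ → Prog σ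
  | 0, _ => fun _ => none
  | n + 1, s => do
    tick
    if cond s then do
      let s' ← body s
      whileFuel cond body n s'
    else
      pure s

open Classical in
/-- `while cond do body`: the result of `whileFuel` with the least sufficient bound, and `none` if
no bound suffices, which means that the loop does not terminate. -/
noncomputable def whileLoop {σ : Type} (cond : σ → Bool) (body : σ → Prog σ) (s : σ) : Prog σ :=
  fun t =>
    if h : ∃ n, (whileFuel cond body n s t).isSome then whileFuel cond body (Nat.find h) s t
    else none

/-! ### The data structure -/

/-- One level of the tree. Nodes are numbered `0, …, size - 1`; data points are referred to by
their indices, so that a dataset may contain a point several times. -/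
structure Level (d N : ℕ) where
  /-- number of nodes -/
  size : ℕ
  /-- location of each node -/
  loc : ℕ → EuclideanSpace ℝ (Fin d)
  /-- index of the parent in the previous level -/
  parent : ℕ → ℕ
  /-- indices of the children in the next level -/
  children : ℕ → Finset ℕ
  /-- indices of the `R`-neighbors, in the same level -/
  nbrs : ℕ → Finset ℕ
  /-- assigned data -/
  data : ℕ → Finset (Fin N)

/-- The locations of the nodes of a level. -/
def Level.points {d N : ℕ} (V : Level d N) : Fin V.size → EuclideanSpace ℝ (Fin d) :=
  fun j => V.loc j

/-- A level without nodes. -/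
def Level.empty (d N : ℕ) : Level d N :=
  ⟨0, fun _ => 0, fun _ => 0, fun _ => ∅, fun _ => ∅, fun _ => ∅⟩

/-- State of the algorithm: the levels above the parent level, the parent level, and the level
under construction. -/
structure State (d N : ℕ) where
  finished : List (Level d N)
  par : Level d N
  cur : Level d N

/-- Create a new node of the current level at `ζ`, with parent `p`. -/
def State.addNode {d N : ℕ} (s : State d N) (p : ℕ) (ζ : EuclideanSpace ℝ (Fin d)) :
    State d N :=
  { s with
    par := { s.par with
      children := Function.update s.par.children p (insert s.cur.size (s.par.children p)) }
    cur := { s.cur with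
      size := s.cur.size + 1
      loc := Function.update s.cur.loc s.cur.size ζ
      parent := Function.update s.cur.parent s.cur.size p } }

/-- Move data point `i` from parent-level node `r` to current-level node `c`. -/
def State.move {d N : ℕ} (s : State d N) (r c : ℕ) (i : Fin N) : State d N :=
  { s with
    par := { s.par with data := Function.update s.par.data r ((s.par.data r).erase i) }
    cur := { s.cur with data := Function.update s.cur.data c (insert i (s.cur.data c)) } }

/-- A rule for the arbitrary choices of the algorithm. It may depend on the whole state, which is
never the same at two choices of one run, so every sequence of choices comes from such a rule. -/
abbrev Rule (d N : ℕ) : Type := State d N → Finset (Fin N) → Fin N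

/-- The rule chooses an element of the given set. -/
def Rule.Valid {d N : ℕ} (pick : Rule d N) : Prop :=
  ∀ (s : State d N) (A : Finset (Fin N)), A.Nonempty → pick s A ∈ A

/-! ### The algorithm -/

/-- The average of the data points of `A` in the closed ball of radius `R` around `ζ`. -/
noncomputable def localAverage {d N : ℕ} (x : Fin N → EuclideanSpace ℝ (Fin d)) (R : ℝ)
    (A : Finset (Fin N)) (ζ : EuclideanSpace ℝ (Fin d)) :
    Prog (EuclideanSpace ℝ (Fin d)) := do
  let t ← forEach A.toList ((0, 0) : EuclideanSpace ℝ (Fin d) × ℕ) fun t i =>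
    if ‖x i - ζ‖ ≤ R then pure (t.1 + x i, t.2 + 1) else pure t
  pure ((t.2 : ℝ)⁻¹ • t.1)

/-- Whether `ζ` has distance `> R` from all present children of the `R`-neighbors of `p`. -/
noncomputable def isFar {d N : ℕ} (R : ℝ) (s : State d N) (p : ℕ)
    (ζ : EuclideanSpace ℝ (Fin d)) : Prog Bool :=
  forEach (s.par.nbrs p).toList true fun ok r =>
    forEach (s.par.children r).toList ok fun ok c =>
      if R < ‖ζ - s.cur.loc c‖ then pure ok else pure false

/-- Body of the `while` loop for parent `p`: choose an assigned data point, optionally replace it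
by the local average, create a child there, and give the child all data points within distance
`R` that are still assigned to `R`-neighbors of `p`. -/
noncomputable def addChild {d N : ℕ} (x : Fin N → EuclideanSpace ℝ (Fin d)) (lloyd : Bool)
    (pick : Rule d N) (R : ℝ) (p : ℕ) (s : State d N) : Prog (State d N) := do
  tick
  let ζ₀ := x (pick s (s.par.data p))
  let ζ ← (if lloyd then do
      let ζ' ← localAverage x R (s.par.data p) ζ₀
      let ok ← isFar R s p ζ'
      pure (if ok then ζ' else ζ₀)
    else pure ζ₀ : Prog (EuclideanSpace ℝ (Fin d)))
  let c := s.cur.size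
  forEach (s.par.nbrs p).toList (s.addNode p ζ) fun s r =>
    forEach (s.par.data r).toList s fun s i =>
      if ‖x i - ζ‖ ≤ R then pure (s.move r c i) else pure s

/-- Create the nodes of the current level: the loop over all parents. -/
noncomputable def addChildren {d N : ℕ} (x : Fin N → EuclideanSpace ℝ (Fin d)) (lloyd : Bool)
    (pick : Rule d N) (R : ℝ) (s : State d N) : Prog (State d N) :=
  forEach (List.range s.par.size) s fun s p =>
    whileLoop (fun s => decide (s.par.data p).Nonempty) (addChild x lloyd pick R p) s

/-- Compute the `R`-neighbors of all nodes of the current level: the children of the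
`R`-neighbors of the node's parent that lie within distance `D` of the node. -/
noncomputable def setNbrs {d N : ℕ} (D : ℝ) (s : State d N) : Prog (State d N) :=
  forEach (List.range s.cur.size) s fun s v => do
    let S ← forEach (s.par.nbrs (s.cur.parent v)).toList ∅ fun S r =>
      forEach (s.par.children r).toList S fun S c =>
        if ‖s.cur.loc c - s.cur.loc v‖ ≤ D then pure (insert c S) else pure S
    pure { s with cur := { s.cur with nbrs := Function.update s.cur.nbrs v S } }

/-- Copy the assigned data of the parent level. -/
noncomputable def copyData {d N : ℕ} (s : State d N) : Prog (ℕ → Finset (Fin N)) :=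
  forEach (List.range s.par.size) (fun _ => ∅) fun A p => do
    tick
    let B ← forEach (s.par.data p).toList ∅ fun B i => pure (insert i B)
    pure (Function.update A p B)

/-- For every data point of the copy `A`, the distance to the closest node of the current level,
searching only the children of the `R`-neighbors of the parent-level node holding the point. -/
noncomputable def nearest {d N : ℕ} (x : Fin N → EuclideanSpace ℝ (Fin d))
    (A : ℕ → Finset (Fin N)) (s : State d N) : Prog (Fin N → ENNReal) :=
  forEach (List.range s.par.size) (fun _ => ⊤) fun near r =>
    forEach (A r).toList near fun near i => do
      let m ← forEach (s.par.nbrs r).toList (⊤ : ENNReal) fun m q =>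
        forEach (s.par.children q).toList m fun m c =>
          pure (min m (ENNReal.ofReal ‖x i - s.cur.loc c‖))
      pure (Function.update near i m)

/-- Voronoi repartitioning: the new assigned data of a node `v` of the current level are those
points, among the data `A r` of the `R`-neighbors `r` of the parent of `v`, for which no node is
closer than `v`. -/
noncomputable def voronoiStep {d N : ℕ} (x : Fin N → EuclideanSpace ℝ (Fin d))
    (A : ℕ → Finset (Fin N)) (s : State d N) : Prog (State d N) := do
  let near ← nearest x A s
  forEach (List.range s.cur.size) s fun s v => do
    let B ← forEach (s.par.nbrs (s.cur.parent v)).toList ∅ fun B r =>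
      forEach (A r).toList B fun B i =>
        if ENNReal.ofReal ‖x i - s.cur.loc v‖ ≤ near i then pure (insert i B) else pure B
    pure { s with cur := { s.cur with data := Function.update s.cur.data v B } }

/-- The radii `R_0 = 2^L ε`, `R_ℓ = R_{ℓ-1} / 2`. -/
noncomputable def radius (L : ℕ) (ε : ℝ) : ℕ → ℝ
  | 0 => 2 ^ L * ε
  | ℓ + 1 => radius L ε ℓ / 2

/-- The radius `4 (1 - 1 / 2^(K - ℓ)) R_ℓ` of the search for `R`-neighbors at level `ℓ`, where
`K = L + 1` is the number of levels and the levels are `0, …, K - 1`. -/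
noncomputable def nbrRadius (L : ℕ) (ε : ℝ) (ℓ : ℕ) : ℝ :=
  4 * (1 - 1 / 2 ^ (L + 1 - ℓ)) * radius L ε ℓ

/-- Construct level `ℓ ≥ 1`: the last level built so far becomes the parent level. -/
noncomputable def buildLevel {d N : ℕ} (x : Fin N → EuclideanSpace ℝ (Fin d)) (ε : ℝ)
    (lloyd voronoi : Bool) (pick : Rule d N) (L ℓ : ℕ)
    (T : List (Level d N) × Level d N) : Prog (List (Level d N) × Level d N) := do
  tick
  let s : State d N := ⟨T.1, T.2, Level.empty d N⟩
  let A ← (if voronoi then copyData s else pure fun _ => ∅ : Prog (ℕ → Finset (Fin N)))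
  let s ← addChildren x lloyd pick (radius L ε ℓ) s
  let s ← setNbrs (nbrRadius L ε ℓ) s
  let s ← (if voronoi then voronoiStep x A s else pure s : Prog (State d N))
  pure (s.finished ++ [s.par], s.cur)

/-- The cover tree algorithm. `lloyd` and `voronoi` switch the two optional steps on. The output
is the list of the levels of the tree, the root first. -/
noncomputable def coverTree {d N : ℕ} (x : Fin N → EuclideanSpace ℝ (Fin d)) (ε : ℝ)
    (lloyd voronoi : Bool) (pick : Rule d N) : Prog (List (Level d N)) := do
  tick
  let sum ← forEach (List.finRange N) (0 : EuclideanSpace ℝ (Fin d)) fun t i => pure (t + x i)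
  let z₀ := (N : ℝ)⁻¹ • sum
  let dmax ← forEach (List.finRange N) (0 : ℝ) fun m i => pure (max m ‖z₀ - x i‖)
  let A₀ ← forEach (List.finRange N) (∅ : Finset (Fin N)) fun A i => pure (insert i A)
  let L := depth dmax ε
  let root : Level d N :=
    ⟨1, fun _ => z₀, fun _ => 0, fun _ => ∅, Function.update (fun _ => ∅) 0 {0},
      Function.update (fun _ => ∅) 0 A₀⟩
  let T ← forEach (List.range L) (([], root) : List (Level d N) × Level d N) fun T k =>
    buildLevel x ε lloyd voronoi pick L (k + 1) T
  pure (T.1 ++ [T.2])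

/-- The list of levels forms a rooted tree with these levels: there is one root, no level is
empty, every node of a level below the root's has exactly one parent, which is a node of the
previous level, and the recorded children of a node are the nodes whose parent it is. -/
structure IsRootedTree {d N : ℕ} (T : List (Level d N)) : Prop where
  root : ∃ h : 0 < T.length, T[0].size = 1
  nonempty : ∀ (ℓ : ℕ) (h : ℓ < T.length), 0 < T[ℓ].size
  parent_lt : ∀ (ℓ : ℕ) (h : ℓ + 1 < T.length), ∀ c < T[ℓ + 1].size,
    T[ℓ + 1].parent c < T[ℓ].size
  mem_children : ∀ (ℓ : ℕ) (h : ℓ + 1 < T.length), ∀ p < T[ℓ].size, ∀ c : ℕ,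
    c ∈ T[ℓ].children p ↔ c < T[ℓ + 1].size ∧ T[ℓ + 1].parent c = p

end CoverTree

namespace CoverTree

/-! ### A program logic for step-counting programs -/

/-! Write `ρ = R_ℓ`, so that the parent level has radius `2ρ`, and let `D` be its search radius for
`R`-neighbors. Correctness rests on one invariant, `Refines`: the nodes created so far are more than
`ρ` apart, data still held by the parent level are more than `ρ` away from all of them, and data
already handed over lie within `ρ` of their node. A new node needs to be compared only with what
belongs to `R`-neighbors of its parent `p`. Anything else belongs to a node more than `D ≥ 5ρ` from
`p`, and two displacements of at most `2ρ` leave a gap of more than `ρ` (`lt_norm_sub_of_far`,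
`Refines.addNode`). A local average stays within `2ρ` of `p` and within `ρ` of the chosen datum by
convexity, so it is as good a location as the datum itself.

The search radii satisfy `D = E + 4ρ`, where `E` is the radius of the new level (`nbrRadius_succ`).
Nodes within `E` of each other therefore have parents within `D`, and searching the children of
`R`-neighbors finds exactly the nodes within `E` (`setNbrs_meets`). Voronoi repartitioning keeps the
covering because the search for a datum includes the node that received it before (`nearest_meets`).

Costs come from packing (`card_le_ballPacking`): a node has at most `P_4` neighbors and at most
`P_1` children, and a datum is held by at most `P_1` nodes. The bound on children also makes the
`while` loop terminate, since every iteration creates a child. Summing over a level gives `O(P_4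
P_1² N)` steps (`buildLevel_meets`), and the number of levels is logarithmic (`depth_add_one_le`).
-/

/-- Started with any step counter, the program terminates after at most `k` steps with a result
satisfying `Q`. -/
def Meets {α : Type} (m : Prog α) (k : ℕ) (Q : α → Prop) : Prop :=
  ∀ t, ∃ a u, m t = some (a, u) ∧ u ≤ t + k ∧ Q a

namespace Meets

variable {α β σ : Type} {m : Prog α} {k l : ℕ} {P Q : α → Prop}

theorem mono (h : Meets m k P) (hk : k ≤ l) (hQ : ∀ a, P a → Q a) : Meets m l Q := by
  intro t
  obtain ⟨a, u, h1, h2, h3⟩ := h t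
  exact ⟨a, u, h1, by omega, hQ a h3⟩

theorem pure {a : α} (h : Q a) : Meets (Pure.pure a) k Q :=
  fun t => ⟨a, t, rfl, by omega, h⟩

theorem bind {f : α → Prog β} {Q : β → Prop} (h : Meets m k P)
    (hf : ∀ a, P a → Meets (f a) l Q) : Meets (m >>= f) (k + l) Q := by
  intro t
  obtain ⟨a, u, h1, h2, h3⟩ := h t
  obtain ⟨b, v, h4, h5, h6⟩ := hf a h3 u
  refine ⟨b, v, ?_, by omega, h6⟩
  change (m t >>= fun p => f p.1 p.2) = _
  rw [h1]
  exact h4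

theorem tick : Meets CoverTree.tick 1 fun _ => True :=
  fun t => ⟨(), t + 1, rfl, le_rfl, trivial⟩

theorem tick_bind {f : Unit → Prog β} {Q : β → Prop} (h : Meets (f ()) k Q) :
    Meets (CoverTree.tick >>= f) (k + 1) Q := by
  rw [add_comm]
  exact bind tick fun _ _ => h

/-- The invariant refers to the list of treated elements, and the cost `f` may vary with the
element; this lets costs of nested loops be added up before they are estimated. -/
theorem forEach {l : List α} {s : σ} {body : σ → α → Prog σ} (I : List α → σ → Prop)
    (f : α → ℕ) (h0 : I [] s)
    (step : ∀ done, ∀ a ∈ l, ∀ s, I done s → Meets (body s a) (f a) (I (done ++ [a]))) :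
    Meets (forEach l s body) (l.map fun a => f a + 1).sum (I l) := by
  suffices H : ∀ (rest done : List α) (s : σ), (∀ a ∈ rest, a ∈ l) → I done s →
      Meets (CoverTree.forEach rest s body) (rest.map fun a => f a + 1).sum (I (done ++ rest)) from
    H l [] s (fun _ h => h) h0
  intro rest
  induction rest with
  | nil =>
    intro done s _ h
    simpa [CoverTree.forEach] using pure (k := 0) h
  | cons a rest ih =>
    intro done s hl h
    have h1 := step done a (hl a (by simp)) s h
    have h2 := bind (tick_bind (f := fun _ => body s a) h1) fun s' hs' =>
      ih (done ++ [a]) s' (fun b hb => hl b (by simp [hb])) hs'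
    simpa [CoverTree.forEach, List.foldlM_cons] using h2

theorem forEach_finset {S : Finset α} {s : σ} {body : σ → α → Prog σ} (I : List α → σ → Prop)
    (f : α → ℕ) (h0 : I [] s)
    (step : ∀ done, ∀ a ∈ S, ∀ s, I done s → Meets (body s a) (f a) (I (done ++ [a]))) :
    Meets (CoverTree.forEach S.toList s body) (∑ a ∈ S, (f a + 1)) (I S.toList) := by
  rw [← Finset.sum_map_toList]
  exact forEach I f h0 fun done a ha => step done a (Finset.mem_toList.1 ha)

theorem forEach_range {n : ℕ} {s : σ} {body : σ → ℕ → Prog σ} (I : List ℕ → σ → Prop)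
    (f : ℕ → ℕ) (h0 : I [] s)
    (step : ∀ done, ∀ a < n, ∀ s, I done s → Meets (body s a) (f a) (I (done ++ [a]))) :
    Meets (CoverTree.forEach (List.range n) s body) (∑ a ∈ Finset.range n, (f a + 1))
      (I (List.range n)) :=
  forEach I f h0 fun done a ha => step done a (List.mem_range.1 ha)

theorem forEach_range_index {n k : ℕ} {s : σ} {body : σ → ℕ → Prog σ} (I : ℕ → σ → Prop)
    (h0 : I 0 s) (step : ∀ a < n, ∀ s, I a s → Meets (body s a) k (I (a + 1))) :
    Meets (CoverTree.forEach (List.range n) s body) (n * (k + 1)) (I n) := by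
  induction n with
  | zero => exact pure h0
  | succ n ih =>
    have h := bind (ih fun a ha => step a (by omega)) fun s' hs' =>
      tick_bind (f := fun _ => body s' n) (step n (by omega) s' hs')
    simpa [CoverTree.forEach, List.range_succ, List.foldlM_append, Nat.succ_mul] using h

end Meets

theorem whileFuel_succ {σ : Type} {cond : σ → Bool} {body : σ → Prog σ} :
    ∀ (n : ℕ) (s : σ) (t : ℕ) (r : σ × ℕ), whileFuel cond body n s t = some r →
      whileFuel cond body (n + 1) s t = some r
  | 0, s, t, r, h => by simp [whileFuel] at h
  | n + 1, s, t, r, h => by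
    rw [whileFuel] at h ⊢
    change (if cond s then body s >>= fun s' => whileFuel cond body n s' else pure s :
      Prog σ) (t + 1) = _ at h
    change (if cond s then body s >>= fun s' => whileFuel cond body (n + 1) s' else pure s :
      Prog σ) (t + 1) = _
    split_ifs at h ⊢ with hc
    · change (body s (t + 1) >>= fun p => whileFuel cond body n p.1 p.2) = _ at h
      change (body s (t + 1) >>= fun p => whileFuel cond body (n + 1) p.1 p.2) = _
      cases hb : body s (t + 1) with
      | none => simp [hb] at h
      | some p =>
        rw [hb] at h
        exact whileFuel_succ n p.1 p.2 r h
    · exact h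

/-- Makes the result of a terminating loop independent of the fuel, so that any sufficient fuel may
replace the least one in `whileLoop`. -/
theorem whileFuel_le {σ : Type} {cond : σ → Bool} {body : σ → Prog σ} {n n' : ℕ} (hn : n ≤ n')
    {s : σ} {t : ℕ} {r : σ × ℕ} (h : whileFuel cond body n s t = some r) :
    whileFuel cond body n' s t = some r := by
  induction hn with
  | refl => exact h
  | step _ ih => exact whileFuel_succ _ _ _ _ ih

/-- A loop whose body decreases the variant `μ` terminates. -/
theorem Meets.whileLoop {σ : Type} {cond : σ → Bool} {body : σ → Prog σ} {k : ℕ}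
    (I : σ → Prop) (μ : σ → ℕ)
    (step : ∀ s, I s → cond s = true → Meets (body s) k fun s' => I s' ∧ μ s' < μ s)
    {s : σ} (h0 : I s) {m : ℕ} (hm : μ s ≤ m) :
    Meets (whileLoop cond body s) (m * (k + 1) + 1) fun s' => I s' ∧ cond s' = false := by
  have fuel : ∀ (m : ℕ) (s : σ), I s → μ s ≤ m →
      Meets (whileFuel cond body (m + 1) s) (m * (k + 1) + 1)
        fun s' => I s' ∧ cond s' = false := by
    intro m
    induction m with
    | zero =>
      intro s hs hm
      rw [whileFuel, zero_mul]
      refine tick_bind ?_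
      split_ifs with hc
      -- With variant `0` the body cannot run: its result would have a smaller variant.
      · intro t
        obtain ⟨a, u, -, -, -, h⟩ := step s hs hc t
        omega
      · exact pure ⟨hs, by simpa using hc⟩
    | succ m ih =>
      intro s hs hm
      rw [whileFuel]
      refine tick_bind ?_
      split_ifs with hc
      · refine (bind (step s hs hc) fun s' hs' => ih s' hs'.1 (by omega)).mono ?_ fun _ h => h
        rw [Nat.succ_mul]
        omega
      · exact pure ⟨hs, by simpa using hc⟩
  intro t
  obtain ⟨a, u, h1, h2⟩ := fuel m s h0 hm t
  refine ⟨a, u, ?_, h2⟩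
  have hex : ∃ n, (whileFuel cond body n s t).isSome := ⟨m + 1, by simp [h1]⟩
  rw [CoverTree.whileLoop, dif_pos hex]
  obtain ⟨r, hr⟩ := Option.isSome_iff_exists.1 (Nat.find_spec hex)
  rw [hr, ← whileFuel_le (Nat.find_min' hex (by rw [h1]; rfl)) hr, h1]

/-! ### Packing bounds -/

/-- Finiteness is needed because `toNat` in `ballPacking` would send `⊤` to `0`. By compactness
finitely many balls of radius `1/4` cover, and they bound the packing number at scale `1/2`. -/
theorem packingNumber_ball_ne_top (d : ℕ) (r : ℝ) :
    Metric.packingNumber (1 / 2 : NNReal)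
      (Metric.closedBall (0 : EuclideanSpace ℝ (Fin d)) r) ≠ ⊤ := by
  obtain ⟨C, -, hfin, hC⟩ := Metric.exists_finite_isCover_of_isCompact
    (ε := (1 / 4 : NNReal)) (by simp)
    (isCompact_closedBall (0 : EuclideanSpace ℝ (Fin d)) r)
  have h := (Metric.packingNumber_two_mul_le_externalCoveringNumber (1 / 4 : NNReal)
    (Metric.closedBall (0 : EuclideanSpace ℝ (Fin d)) r)).trans hC.externalCoveringNumber_le_encard
  rw [show (2 * (1 / 4) : NNReal) = 1 / 2 by norm_num] at h
  exact ne_top_of_le_ne_top (Set.encard_ne_top_iff.2 hfin) h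

/-- Translating by `y` and dividing by `2 * ρ` turns the separation `ρ` into `1/2` and the radius
into `k`. All counting bounds are instances of this. -/
theorem card_le_ballPacking {d : ℕ} {S : Finset ℕ} {loc : ℕ → EuclideanSpace ℝ (Fin d)}
    {y : EuclideanSpace ℝ (Fin d)} {ρ k : ℝ} (hρ : 0 < ρ)
    (hS : ∀ i ∈ S, ‖loc i - y‖ ≤ k * (2 * ρ))
    (hsep : ∀ i ∈ S, ∀ j ∈ S, i ≠ j → ρ < ‖loc i - loc j‖) : S.card ≤ ballPacking d k := by
  have h2 : (0 : ℝ) < 2 * ρ := by positivity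
  have hdist : ∀ i j, ‖(2 * ρ)⁻¹ • (loc i - y) - (2 * ρ)⁻¹ • (loc j - y)‖
      = (2 * ρ)⁻¹ * ‖loc i - loc j‖ := fun i j => by
    rw [← smul_sub, norm_smul, sub_sub_sub_cancel_right, Real.norm_of_nonneg (by positivity)]
  have hhalf : ∀ i ∈ S, ∀ j ∈ S, i ≠ j →
      1 / 2 < ‖(2 * ρ)⁻¹ • (loc i - y) - (2 * ρ)⁻¹ • (loc j - y)‖ := fun i hi j hj hij => by
    rw [hdist, inv_mul_eq_div, lt_div_iff₀ h2]
    linarith [hsep i hi j hj hij]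
  have hinj : Set.InjOn (fun i => (2 * ρ)⁻¹ • (loc i - y)) S := fun i hi j hj hij => by
    by_contra hne
    have := hhalf i hi j hj hne
    simp only at hij
    rw [hij, sub_self, norm_zero] at this
    linarith
  have key := Metric.IsSeparated.encard_le_packingNumber (ε := (1 / 2 : NNReal))
    (C := (fun i => (2 * ρ)⁻¹ • (loc i - y)) '' S)
    (A := Metric.closedBall (0 : EuclideanSpace ℝ (Fin d)) k) ?_ ?_
  · rw [hinj.encard_image, Set.encard_coe_eq_coe_finsetCard] at key
    rw [ballPacking]
    exact ENat.toNat_le_toNat key (packingNumber_ball_ne_top d k)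
  · rintro _ ⟨i, hi, rfl⟩
    rw [mem_closedBall_zero_iff, norm_smul, Real.norm_of_nonneg (by positivity), inv_mul_eq_div,
      div_le_iff₀ h2]
    exact hS i hi
  · rintro _ ⟨i, hi, rfl⟩ _ ⟨j, hj, rfl⟩ hne
    have := hhalf i hi j hj (by rintro rfl; exact hne rfl)
    simp only [edist_dist, dist_eq_norm]
    rw [ENNReal.lt_ofReal_iff_toReal_lt (by simp)]
    simpa using this

theorem one_le_ballPacking (d : ℕ) {r : ℝ} (hr : 0 ≤ r) : 1 ≤ ballPacking d r := by
  simpa using card_le_ballPacking (d := d) (S := {0}) (loc := 0) (y := 0) (ρ := 1) (k := r)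
    one_pos (by simpa using hr) (by simp)

/-- Each of the products of packing numbers below is at most `a * b ^ 2`. -/
theorem packing_products_le {a b : ℕ} (ha : 1 ≤ a) (hb : 1 ≤ b) :
    1 ≤ a * b ^ 2 ∧ b ≤ a * b ^ 2 ∧ a ≤ a * b ^ 2 ∧ a * b ≤ a * b ^ 2 ∧ b * b ≤ a * b ^ 2 := by
  have hbb : b ≤ b ^ 2 := Nat.le_self_pow two_ne_zero b
  have h1 : b ^ 2 ≤ a * b ^ 2 := Nat.le_mul_of_pos_left _ ha
  have h2 : a * b ≤ a * b ^ 2 := Nat.mul_le_mul_left a hbb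
  have h3 : a ≤ a * b := Nat.le_mul_of_pos_right _ hb
  exact ⟨by omega, by omega, by omega, h2, by rwa [← sq]⟩

variable {d N : ℕ} {x : Fin N → EuclideanSpace ℝ (Fin d)}

/-! ### Complete levels -/

/-- A complete level whose nodes are more than `R` apart, whose `R`-neighbors are the nodes within
distance `D`, and which has all data assigned to nodes within distance `R`. -/
structure Level.Good (x : Fin N → EuclideanSpace ℝ (Fin d)) (R D : ℝ) (V : Level d N) :
    Prop where
  size_pos : 0 < V.size
  size_le : V.size ≤ N
  separated : ∀ v < V.size, ∀ w < V.size, v ≠ w → R < ‖V.loc v - V.loc w‖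
  mem_nbrs : ∀ v < V.size, ∀ w, w ∈ V.nbrs v ↔ w < V.size ∧ ‖V.loc w - V.loc v‖ ≤ D
  near : ∀ v < V.size, ∀ i ∈ V.data v, ‖x i - V.loc v‖ ≤ R
  cover : ∀ i, ∃ v < V.size, i ∈ V.data v
  children_eq : V.children = fun _ => ∅

namespace Level.Good

variable {R D : ℝ} {V : Level d N}

theorem nbrs_comm (hV : V.Good x R D) {v w : ℕ} (hv : v < V.size) (h : w ∈ V.nbrs v) :
    v ∈ V.nbrs w := by
  obtain ⟨hw, hD⟩ := (hV.mem_nbrs v hv w).1 h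
  exact (hV.mem_nbrs w hw v).2 ⟨hv, norm_sub_rev (V.loc w) _ ▸ hD⟩

theorem card_nbrs_le (hV : V.Good x R D) (hR : 0 < R) (hD : D ≤ 8 * R) {v : ℕ}
    (hv : v < V.size) : (V.nbrs v).card ≤ ballPacking d 4 := by
  refine card_le_ballPacking (loc := V.loc) (y := V.loc v) hR (fun w hw => ?_)
    fun w hw w' hw' => hV.separated w ((hV.mem_nbrs v hv w).1 hw).1 w'
      ((hV.mem_nbrs v hv w').1 hw').1
  linarith [((hV.mem_nbrs v hv w).1 hw).2]

/-- Ties in the Voronoi step may assign a datum to several nodes. These lie within `R` of it and are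
more than `R` apart, so there are at most `P_1`; double counting does the rest. -/
theorem sum_card_data_le (hV : V.Good x R D) (hR : 0 < R) :
    ∑ v ∈ Finset.range V.size, (V.data v).card ≤ N * ballPacking d 1 := by
  have h := Finset.sum_card_bipartiteAbove_eq_sum_card_bipartiteBelow
    (s := Finset.range V.size) (t := (Finset.univ : Finset (Fin N))) fun v i => i ∈ V.data v
  have h1 : ∀ v, Finset.univ.bipartiteAbove (fun v i => i ∈ V.data v) v = V.data v := fun v => by
    ext i
    simp [Finset.bipartiteAbove]
  simp only [h1] at h
  rw [h]
  refine (Finset.sum_le_card_nsmul _ _ (ballPacking d 1) fun i _ => ?_).trans (by simp)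
  refine card_le_ballPacking (loc := V.loc) (y := x i) hR (fun v hv => ?_) fun v hv w hw => ?_
  · rw [Finset.mem_bipartiteBelow, Finset.mem_range] at hv
    rw [norm_sub_rev]
    linarith [hV.near v hv.1 i hv.2]
  · rw [Finset.mem_bipartiteBelow, Finset.mem_range] at hv hw
    exact hV.separated v hv.1 w hw.1

/-- The neighbor relation is symmetric, so after exchanging the sums each node's data are counted
once per neighbor, at most `P_4` times. -/
theorem sum_nbrs_data_le (hV : V.Good x R D) (hR : 0 < R) (hD : D ≤ 8 * R) :
    ∑ v ∈ Finset.range V.size, ∑ r ∈ V.nbrs v, (V.data r).card ≤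
      ballPacking d 4 * (N * ballPacking d 1) := by
  rw [Finset.sum_comm' (t' := Finset.range V.size) (s' := V.nbrs)]
  · calc ∑ r ∈ Finset.range V.size, ∑ v ∈ V.nbrs r, (V.data r).card
        ≤ ∑ r ∈ Finset.range V.size, ballPacking d 4 * (V.data r).card := by
          refine Finset.sum_le_sum fun r hr => ?_
          rw [Finset.sum_const, smul_eq_mul]
          exact Nat.mul_le_mul_right _ (hV.card_nbrs_le hR hD (Finset.mem_range.1 hr))
      _ ≤ _ := by
          rw [← Finset.mul_sum]
          exact Nat.mul_le_mul_left _ (hV.sum_card_data_le hR)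
  · intro v r
    simp only [Finset.mem_range]
    constructor
    · rintro ⟨hv, h⟩
      exact ⟨hV.nbrs_comm hv h, ((hV.mem_nbrs v hv r).1 h).1⟩
    · rintro ⟨h, hr⟩
      exact ⟨((hV.mem_nbrs r hr v).1 h).1, hV.nbrs_comm hr h⟩

end Level.Good

/-! ### Levels under construction -/

/-- The nodes created so far below the complete level `V` are more than `ρ` apart, and they cover
the data that are no longer assigned to nodes of `V`. -/
structure Refines (x : Fin N → EuclideanSpace ℝ (Fin d)) (ρ : ℝ) (V : Level d N)
    (s : State d N) : Prop where
  size_eq : s.par.size = V.size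
  loc_eq : s.par.loc = V.loc
  parent_eq : s.par.parent = V.parent
  nbrs_eq : s.par.nbrs = V.nbrs
  data_subset : ∀ r, s.par.data r ⊆ V.data r
  mem_children : ∀ p c, c ∈ s.par.children p ↔ c < s.cur.size ∧ s.cur.parent c = p
  parent_lt : ∀ c < s.cur.size, s.cur.parent c < V.size
  near_parent : ∀ c < s.cur.size, ‖s.cur.loc c - V.loc (s.cur.parent c)‖ ≤ 2 * ρ
  separated : ∀ c < s.cur.size, ∀ c' < s.cur.size, c ≠ c' → ρ < ‖s.cur.loc c - s.cur.loc c'‖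
  far : ∀ r < V.size, ∀ i ∈ s.par.data r, ∀ c < s.cur.size, ρ < ‖x i - s.cur.loc c‖
  assigned : ∀ r < V.size, ∀ i ∈ V.data r, i ∈ s.par.data r ∨
    ∃ c < s.cur.size, i ∈ s.cur.data c ∧ r ∈ V.nbrs (s.cur.parent c)
  data_near : ∀ c, ∀ i ∈ s.cur.data c, c < s.cur.size ∧ ‖x i - s.cur.loc c‖ ≤ ρ
  size_le : ∃ A : Finset (Fin N), s.cur.size ≤ A.card ∧
    ∀ i ∈ A, ∃ c < s.cur.size, ‖x i - s.cur.loc c‖ ≤ ρ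
  children_eq : s.cur.children = fun _ => ∅

theorem Refines.card_children_le {ρ : ℝ} {V : Level d N} {s : State d N} (h : Refines x ρ V s)
    (hρ : 0 < ρ) (p : ℕ) : (s.par.children p).card ≤ ballPacking d 1 := by
  refine card_le_ballPacking (loc := s.cur.loc) (y := V.loc p) hρ (fun c hc => ?_)
    fun c hc c' hc' => h.separated c ((h.mem_children p c).1 hc).1 c'
      ((h.mem_children p c').1 hc').1
  obtain ⟨hc', rfl⟩ := (h.mem_children p c).1 hc
  simpa using h.near_parent c hc'

theorem Refines.start {ρ R D : ℝ} {V : Level d N} (hV : V.Good x R D) (F : List (Level d N)) :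
    Refines x ρ V ⟨F, V, Level.empty d N⟩ where
  size_eq := rfl
  loc_eq := rfl
  parent_eq := rfl
  nbrs_eq := rfl
  data_subset _ := subset_rfl
  mem_children p c := by simp [hV.children_eq, Level.empty]
  parent_lt c hc := by simp [Level.empty] at hc
  near_parent c hc := by simp [Level.empty] at hc
  separated c hc := by simp [Level.empty] at hc
  far r _ i _ c hc := by simp [Level.empty] at hc
  assigned r _ i hi := Or.inl hi
  data_near c i hi := by simp [Level.empty] at hi
  size_le := ⟨∅, by simp [Level.empty]⟩
  children_eq := rfl

theorem lt_norm_sub_of_far {E : Type*} [SeminormedAddCommGroup E] {ρ : ℝ} {a b y z : E}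
    (h : 5 * ρ < ‖b - a‖) (hy : ‖y - b‖ ≤ 2 * ρ) (hz : ‖z - a‖ ≤ 2 * ρ) : ρ < ‖y - z‖ := by
  have h1 : b - a = (y - z) - (y - b) + (z - a) := by abel
  have h2 := norm_add_le ((y - z) - (y - b)) (z - a)
  have h3 := norm_sub_le (y - z) (y - b)
  rw [← h1] at h2
  linarith

/-! ### Creating a child -/

/-- Balls are convex: one that contains the averaged points contains their mean. This is used for a
ball around the parent and for one around the chosen datum, whose own presence makes the count
positive. -/
theorem localAverage_meets {A : Finset (Fin N)} {i₀ : Fin N} {R : ℝ} (hi₀ : i₀ ∈ A)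
    (hR : 0 ≤ R) :
    Meets (localAverage x R A (x i₀)) A.card fun y => ∀ u r,
      (∀ i ∈ A, ‖x i - x i₀‖ ≤ R → ‖x i - u‖ ≤ r) → ‖y - u‖ ≤ r := by
  have h := Meets.forEach_finset (S := A) (s := ((0, 0) : EuclideanSpace ℝ (Fin d) × ℕ))
    (body := fun t i => if ‖x i - x i₀‖ ≤ R then pure (t.1 + x i, t.2 + 1) else pure t)
    (fun done t => (i₀ ∈ done → 0 < t.2) ∧ ∀ u r,
      (∀ i ∈ A, ‖x i - x i₀‖ ≤ R → ‖x i - u‖ ≤ r) → ‖t.1 - (t.2 : ℝ) • u‖ ≤ t.2 * r)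
    (fun _ => 0) (by simp) fun done i hi t ht => by
      split_ifs with hc
      · refine Meets.pure ⟨fun _ => Nat.succ_pos _, fun u r hu => ?_⟩
        have e : t.1 + x i - ((t.2 + 1 : ℕ) : ℝ) • u = (t.1 - (t.2 : ℝ) • u) + (x i - u) := by
          push_cast
          rw [add_smul, one_smul]
          abel
        rw [e]
        refine (norm_add_le _ _).trans ?_
        push_cast
        linarith [ht.2 u r hu, hu i hi hc]
      · refine Meets.pure ⟨fun hm => ht.1 ?_, ht.2⟩
        rcases List.mem_append.1 hm with hm | hm
        · exact hm
        · rw [← List.mem_singleton.1 hm, sub_self, norm_zero] at hc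
          exact absurd hR hc
  refine (Meets.bind h fun t ht => Meets.pure (k := 0) fun u r hu => ?_).mono (by simp)
    fun _ h => h
  have ht0 : (0 : ℝ) < t.2 := by exact_mod_cast ht.1 (Finset.mem_toList.2 hi₀)
  have e : (t.2 : ℝ)⁻¹ • t.1 - u = (t.2 : ℝ)⁻¹ • (t.1 - (t.2 : ℝ) • u) := by
    rw [smul_sub, smul_smul, inv_mul_cancel₀ ht0.ne', one_smul]
  rw [e, norm_smul, Real.norm_of_nonneg (by positivity), inv_mul_le_iff₀ ht0]
  exact ht.2 u r hu

theorem isFar_meets {R : ℝ} {s : State d N} {p : ℕ} {ζ : EuclideanSpace ℝ (Fin d)} :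
    Meets (isFar R s p ζ) (∑ r ∈ s.par.nbrs p, ((s.par.children r).card + 1)) fun ok =>
      ok = true → ∀ r ∈ s.par.nbrs p, ∀ c ∈ s.par.children r, R < ‖ζ - s.cur.loc c‖ := by
  refine (Meets.forEach_finset (fun done ok => ok = true → ∀ r ∈ done, ∀ c ∈ s.par.children r,
    R < ‖ζ - s.cur.loc c‖) (fun r => (s.par.children r).card) (by simp)
    fun done r _ ok hok => ?_).mono le_rfl (by simp)
  refine (Meets.forEach_finset (fun done' ok => ok = true →
    (∀ r ∈ done, ∀ c ∈ s.par.children r, R < ‖ζ - s.cur.loc c‖) ∧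
      ∀ c ∈ done', R < ‖ζ - s.cur.loc c‖) (fun _ => 0) (by simpa using hok)
    fun done' c _ ok hok => ?_).mono (by simp) ?_
  · split_ifs with hc
    · refine Meets.pure fun h => ⟨(hok h).1, ?_⟩
      simp only [List.mem_append, List.mem_singleton]
      rintro c' (hc' | rfl)
      exacts [(hok h).2 c' hc', hc]
    · exact Meets.pure (by simp)
  · simp only [Finset.mem_toList, List.mem_append, List.mem_singleton]
    rintro ok h hok' r' (hr | rfl)
    exacts [(h hok').1 r' hr, (h hok').2]

/-! ### Moving data to the new node -/

/-- The state `s` arises from `s₀` by moving data near `ζ` from nodes in `S` to the node `c`; the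
pairs in `done` have been treated. -/
structure Moved (x : Fin N → EuclideanSpace ℝ (Fin d)) (R : ℝ) (ζ : EuclideanSpace ℝ (Fin d))
    (c : ℕ) (S : Finset ℕ) (s₀ : State d N) (done : ℕ → Fin N → Prop) (s : State d N) :
    Prop where
  shape : s = ⟨s₀.finished, { s₀.par with data := s.par.data },
    { s₀.cur with data := s.cur.data }⟩
  data_subset : ∀ r, s.par.data r ⊆ s₀.par.data r
  far : ∀ r i, done r i → i ∈ s.par.data r → R < ‖x i - ζ‖
  subset_data : ∀ c', s₀.cur.data c' ⊆ s.cur.data c'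
  near : ∀ c', ∀ i ∈ s.cur.data c', i ∈ s₀.cur.data c' ∨ c' = c ∧ ‖x i - ζ‖ ≤ R
  assigned : ∀ r, ∀ i ∈ s₀.par.data r, i ∈ s.par.data r ∨ i ∈ s.cur.data c ∧ r ∈ S

namespace Moved

variable {R : ℝ} {ζ : EuclideanSpace ℝ (Fin d)} {c : ℕ} {S : Finset ℕ} {s₀ s : State d N}
  {done done' : ℕ → Fin N → Prop}

theorem start : Moved x R ζ c S s₀ (fun _ _ => False) s₀ :=
  ⟨rfl, fun _ => subset_rfl, fun _ _ h => h.elim, fun _ => subset_rfl, fun _ _ h => Or.inl h,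
    fun _ _ h => Or.inl h⟩

theorem congr (h : Moved x R ζ c S s₀ done s)
    (hd : ∀ r i, i ∈ s.par.data r → done' r i → done r i) : Moved x R ζ c S s₀ done' s :=
  { h with far := fun r i hri hi => h.far r i (hd r i hi hri) hi }

theorem move (h : Moved x R ζ c S s₀ done s) {r : ℕ} (hr : r ∈ S) {i : Fin N}
    (hi : ‖x i - ζ‖ ≤ R) :
    Moved x R ζ c S s₀ (fun r' i' => done r' i' ∨ r' = r ∧ i' = i) (s.move r c i) where
  shape := by
    rw [h.shape]
    rfl
  data_subset r' := by
    by_cases hr' : r' = r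
    · subst hr'
      simpa [State.move] using (Finset.erase_subset _ _).trans (h.data_subset r')
    · simpa [State.move, hr'] using h.data_subset r'
  far r' i' hd hi' := by
    by_cases hr' : r' = r
    · subst hr'
      simp only [State.move, Function.update_self, Finset.mem_erase] at hi'
      rcases hd with hd | ⟨-, rfl⟩
      exacts [h.far _ _ hd hi'.2, absurd rfl hi'.1]
    · simp only [State.move, Function.update_of_ne hr'] at hi'
      rcases hd with hd | ⟨h1, -⟩
      exacts [h.far _ _ hd hi', absurd h1 hr']
  subset_data c' := by
    by_cases hc : c' = c
    · subst hc
      simpa [State.move] using (h.subset_data c').trans (Finset.subset_insert _ _)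
    · simpa [State.move, hc] using h.subset_data c'
  near c' j hj := by
    by_cases hc : c' = c
    · subst hc
      simp only [State.move, Function.update_self, Finset.mem_insert] at hj
      rcases hj with rfl | hj
      exacts [Or.inr ⟨rfl, hi⟩, h.near _ j hj]
    · simp only [State.move, Function.update_of_ne hc] at hj
      exact h.near c' j hj
  assigned r' j hj := by
    simp only [State.move, Function.update_self, Finset.mem_insert]
    rcases h.assigned r' j hj with hj | hj
    · by_cases hr' : r' = r
      · subst hr'
        by_cases hji : j = i
        · exact Or.inr ⟨Or.inl hji, hr⟩
        · exact Or.inl (by simp [hji, hj])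
      · exact Or.inl (by simpa [hr'] using hj)
    · exact Or.inr ⟨Or.inr hj.1, hj.2⟩

end Moved

theorem moveData_meets {R : ℝ} {ζ : EuclideanSpace ℝ (Fin d)} {c : ℕ} {S : Finset ℕ}
    {s₀ : State d N} :
    Meets (forEach S.toList s₀ fun s r => forEach (s.par.data r).toList s fun s i =>
        if ‖x i - ζ‖ ≤ R then pure (s.move r c i) else pure s)
      (∑ r ∈ S, ((s₀.par.data r).card + 1)) (Moved x R ζ c S s₀ fun r _ => r ∈ S) := by
  refine (Meets.forEach_finset (fun done => Moved x R ζ c S s₀ fun r _ => r ∈ done)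
    (fun r => (s₀.par.data r).card) (by simpa using Moved.start) fun done r hr s hs => ?_).mono
    le_rfl (by simp)
  refine (Meets.forEach_finset (fun done' s' => s'.par.data r ⊆ s.par.data r ∧
    Moved x R ζ c S s₀ (fun r' i => r' ∈ done ∨ r' = r ∧ i ∈ done') s') (fun _ => 0)
    (by simpa using hs) fun done' i _ s' hs' => ?_).mono
    (by simpa using Finset.card_le_card (hs.data_subset r)) ?_
  · split_ifs with hc
    · refine Meets.pure ⟨?_, (hs'.2.move hr hc).congr ?_⟩
      · simpa [State.move] using (Finset.erase_subset _ _).trans hs'.1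
      · simp only [List.mem_append, List.mem_singleton]
        tauto
    · refine Meets.pure ⟨hs'.1, { hs'.2 with far := fun r' i' hd hi' => ?_ }⟩
      simp only [List.mem_append, List.mem_singleton] at hd
      rcases hd with hd | ⟨rfl, hd | rfl⟩
      exacts [hs'.2.far _ _ (Or.inl hd) hi', hs'.2.far _ _ (Or.inr ⟨rfl, hd⟩) hi', not_le.1 hc]
  · rintro s' ⟨h1, h2⟩
    -- The inner loop runs over a snapshot of the data of `r`. Data only leave `r`, so whatever
    -- remains there was in the snapshot and has been treated.
    refine h2.congr fun r' i hi hr' => ?_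
    simp only [List.mem_append, List.mem_singleton] at hr'
    rcases hr' with hr' | rfl
    exacts [Or.inl hr', Or.inr ⟨rfl, Finset.mem_toList.2 (h1 hi)⟩]

/-- Remaining data of neighbors of `p` are far from `ζ` because the move has tested them; those of
other nodes are far because `D ≥ 5ρ`. -/
theorem Refines.addNode {ρ D : ℝ} {V : Level d N} {s s' : State d N} (h : Refines x ρ V s)
    (hV : V.Good x (2 * ρ) D) (hD : 5 * ρ ≤ D) {p : ℕ} (hp : p < V.size)
    {ζ : EuclideanSpace ℝ (Fin d)} (hζp : ‖ζ - V.loc p‖ ≤ 2 * ρ)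
    (hζ : ∀ c < s.cur.size, ρ < ‖ζ - s.cur.loc c‖) {i₀ : Fin N} (hi₀ : i₀ ∈ s.par.data p)
    (hζi : ‖x i₀ - ζ‖ ≤ ρ)
    (hs' : Moved x ρ ζ s.cur.size (V.nbrs p) (s.addNode p ζ) (fun r _ => r ∈ V.nbrs p) s') :
    Refines x ρ V s' := by
  obtain ⟨F, P, Q⟩ := s'
  obtain ⟨hshape, hsub, hfar, hsubd, hnear, hass⟩ := hs'
  simp only [State.mk.injEq] at hshape
  obtain ⟨hF, hP, hQ⟩ := hshape
  have hPc : P.children = Function.update s.par.children p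
    (insert s.cur.size (s.par.children p)) := by rw [hP]; rfl
  have hQs : Q.size = s.cur.size + 1 := by rw [hQ]; rfl
  have hQl : Q.loc = Function.update s.cur.loc s.cur.size ζ := by rw [hQ]; rfl
  have hQp : Q.parent = Function.update s.cur.parent s.cur.size p := by rw [hQ]; rfl
  have ll : ∀ c < s.cur.size, Q.loc c = s.cur.loc c := fun c hc => by
    rw [hQl, Function.update_of_ne hc.ne]
  have lp : ∀ c < s.cur.size, Q.parent c = s.cur.parent c := fun c hc => by
    rw [hQp, Function.update_of_ne hc.ne]
  have nl : Q.loc s.cur.size = ζ := by rw [hQl, Function.update_self]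
  have np : Q.parent s.cur.size = p := by rw [hQp, Function.update_self]
  have hlt : ∀ {c}, c < Q.size → c < s.cur.size ∨ c = s.cur.size := fun hc => by omega
  have hle : s.cur.size < Q.size := by omega
  have hsub' : ∀ r, P.data r ⊆ s.par.data r := hsub
  refine ⟨?_, ?_, ?_, ?_, fun r => (hsub r).trans (h.data_subset r), ?_, ?_, ?_, ?_, ?_, ?_, ?_,
    ?_, ?_⟩
  · rw [← h.size_eq]; change P.size = _; rw [hP]; rfl
  · rw [← h.loc_eq]; change P.loc = _; rw [hP]; rfl
  · rw [← h.parent_eq]; change P.parent = _; rw [hP]; rfl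
  · rw [← h.nbrs_eq]; change P.nbrs = _; rw [hP]; rfl
  · intro q c
    change c ∈ P.children q ↔ c < Q.size ∧ Q.parent c = q
    have hm := h.mem_children q c
    rw [hPc]
    rcases lt_trichotomy c s.cur.size with hc | rfl | hc
    · rw [lp c hc]
      by_cases hq : q = p
      · subst hq
        simp [hm, hc, hc.ne, hc.trans hle]
      · simp [hq, hm, hc, hc.trans hle]
    · rw [np]
      by_cases hq : q = p
      · subst hq
        simp [hle]
      · simp [hq, hm, Ne.symm hq]
    · by_cases hq : q = p
      · subst hq
        simp only [Function.update_self, Finset.mem_insert, hm]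
        omega
      · simp only [Function.update_of_ne hq, hm]
        omega
  · intro c hc
    change Q.parent c < V.size
    rcases hlt hc with hc | rfl
    · exact lp c hc ▸ h.parent_lt c hc
    · exact np.symm ▸ hp
  · intro c hc
    change ‖Q.loc c - V.loc (Q.parent c)‖ ≤ 2 * ρ
    rcases hlt hc with hc | rfl
    · rw [ll c hc, lp c hc]
      exact h.near_parent c hc
    · rwa [nl, np]
  · intro c hc c' hc' hne
    change ρ < ‖Q.loc c - Q.loc c'‖
    rcases hlt hc with hc | rfl <;> rcases hlt hc' with hc' | rfl
    · rw [ll c hc, ll c' hc']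
      exact h.separated c hc c' hc' hne
    · rw [ll c hc, nl, norm_sub_rev]
      exact hζ c hc
    · rw [ll c' hc', nl]
      exact hζ c' hc'
    · exact absurd rfl hne
  · intro r hr i hi c hc
    change ρ < ‖x i - Q.loc c‖
    rcases hlt hc with hc | rfl
    · rw [ll c hc]
      exact h.far r hr i (hsub' r hi) c hc
    · rw [nl]
      by_cases hrp : r ∈ V.nbrs p
      · exact hfar r i hrp hi
      · rw [hV.mem_nbrs p hp, not_and, not_le] at hrp
        exact lt_norm_sub_of_far (hD.trans_lt (hrp hr))
          (hV.near r hr i (h.data_subset r (hsub' r hi))) hζp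
  · intro r hr i hi
    change i ∈ P.data r ∨ ∃ c < Q.size, i ∈ Q.data c ∧ r ∈ V.nbrs (Q.parent c)
    rcases h.assigned r hr i hi with hi | ⟨c, hc, hic, hrc⟩
    · rcases hass r i hi with hi | ⟨hi, hrp⟩
      · exact Or.inl hi
      · exact Or.inr ⟨_, hle, hi, np.symm ▸ hrp⟩
    · exact Or.inr ⟨c, hc.trans hle, hsubd c hic, (lp c hc).symm ▸ hrc⟩
  · intro c i hi
    change c < Q.size ∧ ‖x i - Q.loc c‖ ≤ ρ
    rcases hnear c i hi with hi' | ⟨rfl, hi'⟩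
    · obtain ⟨hc, hic⟩ := h.data_near c i hi'
      exact ⟨hc.trans hle, (ll c hc).symm ▸ hic⟩
    · exact ⟨hle, nl.symm ▸ hi'⟩
  · obtain ⟨A, hA, hAc⟩ := h.size_le
    -- Each node is charged to a datum not covered by the earlier nodes. This bounds the number of
    -- nodes by `N` even if nodes sit at averages.
    have hnot : i₀ ∉ A := fun hi => by
      obtain ⟨c, hc, hic⟩ := hAc i₀ hi
      exact hic.not_gt (h.far p hp i₀ hi₀ c hc)
    refine ⟨insert i₀ A, ?_, fun i hi => ?_⟩
    · change Q.size ≤ _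
      rw [Finset.card_insert_of_notMem hnot]
      omega
    · change ∃ c < Q.size, ‖x i - Q.loc c‖ ≤ ρ
      rcases Finset.mem_insert.1 hi with rfl | hi
      · exact ⟨_, hle, nl.symm ▸ hζi⟩
      · obtain ⟨c, hc, hic⟩ := hAc i hi
        exact ⟨c, hc.trans hle, (ll c hc).symm ▸ hic⟩
  · rw [← h.children_eq]
    change Q.children = _
    rw [hQ]
    rfl

/-! ### Termination and cost of creating all children -/

/-- An upper bound for the number of steps that the creation of a child of `p` takes. -/
noncomputable def childCost (V : Level d N) (p : ℕ) : ℕ :=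
  1 + ((V.data p).card + ballPacking d 4 * (ballPacking d 1 + 1)) +
    ∑ r ∈ V.nbrs p, ((V.data r).card + 1)

theorem Refines.sum_card_children_le {ρ D : ℝ} {V : Level d N} {s : State d N}
    (h : Refines x ρ V s) (hV : V.Good x (2 * ρ) D) (hρ : 0 < ρ) (hD : D ≤ 16 * ρ) {p : ℕ}
    (hp : p < V.size) : ∑ r ∈ V.nbrs p, ((s.par.children r).card + 1) ≤
      ballPacking d 4 * (ballPacking d 1 + 1) := by
  refine (Finset.sum_le_card_nsmul _ _ (ballPacking d 1 + 1) fun r _ =>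
    Nat.succ_le_succ (h.card_children_le hρ r)).trans ?_
  rw [smul_eq_mul]
  exact Nat.mul_le_mul_right _ (hV.card_nbrs_le (by positivity) (by linarith) hp)

theorem addChild_meets {ρ D : ℝ} {V : Level d N} {s : State d N} {lloyd : Bool}
    {pick : Rule d N} (hpick : pick.Valid) (h : Refines x ρ V s) (hV : V.Good x (2 * ρ) D)
    (hρ : 0 < ρ) (hD : 5 * ρ ≤ D) (hD' : D ≤ 16 * ρ) {p : ℕ} (hp : p < V.size)
    (hne : (s.par.data p).Nonempty) :
    Meets (addChild x lloyd pick ρ p s) (childCost V p) fun s' =>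
      Refines x ρ V s' ∧ s'.finished = s.finished ∧ (∀ r, s'.par.data r ⊆ s.par.data r) ∧
        (s'.par.children p).card = (s.par.children p).card + 1 := by
  have hi₀ := hpick s _ hne
  rw [addChild]
  set i₀ := pick s (s.par.data p) with hi₀_def
  have hpp : p ∈ V.nbrs p := (hV.mem_nbrs p hp p).2 ⟨hp, by simp; linarith⟩
  have hζ₀ : ‖x i₀ - V.loc p‖ ≤ 2 * ρ := hV.near p hp i₀ (h.data_subset p hi₀)
  have choice : Meets (if lloyd then do
      let ζ' ← localAverage x ρ (s.par.data p) (x i₀)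
      let ok ← isFar ρ s p ζ'
      pure (if ok then ζ' else x i₀)
    else pure (x i₀) : Prog (EuclideanSpace ℝ (Fin d)))
      ((V.data p).card + ballPacking d 4 * (ballPacking d 1 + 1)) fun ζ =>
        ‖ζ - V.loc p‖ ≤ 2 * ρ ∧ (∀ c < s.cur.size, ρ < ‖ζ - s.cur.loc c‖) ∧
          ‖x i₀ - ζ‖ ≤ ρ := by
    have h₀ : ‖x i₀ - V.loc p‖ ≤ 2 * ρ ∧ (∀ c < s.cur.size, ρ < ‖x i₀ - s.cur.loc c‖) ∧
        ‖x i₀ - x i₀‖ ≤ ρ := ⟨hζ₀, h.far p hp i₀ hi₀, by simpa using hρ.le⟩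
    split_ifs with hl
    · refine (Meets.bind (localAverage_meets hi₀ hρ.le) fun ζ' hζ' =>
        Meets.bind isFar_meets fun ok hok => Meets.pure (k := 0) ?_).mono ?_ fun _ h => h
      · split_ifs with hk
        · have h1 := hζ' (V.loc p) (2 * ρ) fun i hi _ => hV.near p hp i (h.data_subset p hi)
          refine ⟨h1, fun c hc => ?_, ?_⟩
          -- The test in `isFar` sees only children of neighbors of `p`; the other nodes are
          -- excluded by the triangle inequality.
          · by_cases hcp : s.cur.parent c ∈ V.nbrs p
            · exact hok hk _ (h.nbrs_eq ▸ hcp) c ((h.mem_children _ c).2 ⟨hc, rfl⟩)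
            · have hcV := h.parent_lt c hc
              rw [hV.mem_nbrs p hp, not_and, not_le] at hcp
              rw [norm_sub_rev]
              exact lt_norm_sub_of_far (hD.trans_lt (hcp hcV)) (h.near_parent c hc) h1
          · rw [norm_sub_rev]
            exact hζ' (x i₀) ρ fun i _ hi => hi
        · exact h₀
      · rw [h.nbrs_eq]
        exact Nat.add_le_add (Finset.card_le_card (h.data_subset p))
          (h.sum_card_children_le hV hρ hD' hp)
    · exact Meets.pure h₀
  refine (Meets.tick_bind (Meets.bind choice fun ζ hζ => ?_)).mono
    (k := ((V.data p).card + ballPacking d 4 * (ballPacking d 1 + 1)) +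
      (∑ r ∈ V.nbrs p, ((V.data r).card + 1)) + 1) (by rw [childCost]; omega) fun _ h => h
  rw [h.nbrs_eq]
  refine moveData_meets.mono (Finset.sum_le_sum fun r _ =>
    Nat.succ_le_succ (Finset.card_le_card (h.data_subset r))) fun s' hs' =>
      ⟨h.addNode hV hD hp hζ.1 hζ.2.1 hi₀ hζ.2.2 hs', ?_, hs'.data_subset, ?_⟩
  · rw [hs'.shape]
    rfl
  · rw [hs'.shape]
    change (Function.update s.par.children p (insert s.cur.size (s.par.children p)) p).card = _
    rw [Function.update_self, Finset.card_insert_of_notMem]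
    simp [h.mem_children]

theorem addChildren_meets {ρ D : ℝ} {V : Level d N} {s : State d N} {lloyd : Bool}
    {pick : Rule d N} (hpick : pick.Valid) (h : Refines x ρ V s) (hV : V.Good x (2 * ρ) D)
    (hρ : 0 < ρ) (hD : 5 * ρ ≤ D) (hD' : D ≤ 16 * ρ) :
    Meets (addChildren x lloyd pick ρ s)
      (9 * (N * (ballPacking d 4 * ballPacking d 1 ^ 2))) fun s' =>
        Refines x ρ V s' ∧ s'.finished = s.finished ∧ ∀ r < V.size, s'.par.data r = ∅ := by
  rw [addChildren, h.size_eq]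
  refine (Meets.forEach_range (fun done s' => Refines x ρ V s' ∧ s'.finished = s.finished ∧
    ∀ r ∈ done, s'.par.data r = ∅) (fun p => ballPacking d 1 * (childCost V p + 1) + 1)
    ⟨h, rfl, by simp⟩ fun done p hp s₁ hs₁ => ?_).mono ?_ (by simp)
  · refine (Meets.whileLoop (fun s' => Refines x ρ V s' ∧ s'.finished = s.finished ∧
      ∀ r ∈ done, s'.par.data r = ∅)
      -- The truncated difference strictly decreases, since even after the new child the packing
      -- bound on the children of `p` still holds.
      (fun s' => ballPacking d 1 - (s'.par.children p).card) (k := childCost V p)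
      (fun s₂ hs₂ hc => ?_) hs₁ (Nat.sub_le _ _)).mono le_rfl ?_
    · refine (addChild_meets hpick hs₂.1 hV hρ hD hD' hp (of_decide_eq_true hc)).mono le_rfl ?_
      rintro s₃ ⟨h1, h2, h3, h4⟩
      refine ⟨⟨h1, h2.trans hs₂.2.1, fun r hr => ?_⟩, ?_⟩
      · exact Finset.subset_empty.1 (hs₂.2.2 r hr ▸ h3 r)
      · have := h1.card_children_le hρ p
        omega
    · rintro s₂ ⟨⟨h1, h2, h3⟩, h4⟩
      refine ⟨h1, h2, fun r hr => ?_⟩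
      rcases List.mem_append.1 hr with hr | hr
      · exact h3 r hr
      · rw [List.mem_singleton.1 hr]
        exact Finset.not_nonempty_iff_eq_empty.1 (of_decide_eq_false h4)
  · have hR : 0 < 2 * ρ := by positivity
    have e1 := hV.sum_card_data_le hR
    have e2 := hV.sum_nbrs_data_le hR (by linarith)
    have e3 : ∑ v ∈ Finset.range V.size, (V.nbrs v).card ≤ V.size * ballPacking d 4 := by
      refine (Finset.sum_le_card_nsmul _ _ (ballPacking d 4) fun v hv =>
        hV.card_nbrs_le hR (by linarith) (Finset.mem_range.1 hv)).trans (by simp)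
    have e4 := hV.size_le
    have a1 := one_le_ballPacking d (r := 4) (by norm_num)
    have b1 := one_le_ballPacking d (r := 1) (by norm_num)
    simp only [childCost, mul_add, Finset.sum_add_distrib, ← Finset.mul_sum, Finset.sum_const,
      Finset.card_range, smul_eq_mul, mul_one]
    generalize ballPacking d 4 = a at *
    generalize ballPacking d 1 = b at *
    generalize V.size = n at *
    generalize ∑ v ∈ Finset.range n, (V.data v).card = S1 at *
    generalize ∑ v ∈ Finset.range n, ∑ r ∈ V.nbrs v, (V.data r).card = S2 at *
    generalize ∑ v ∈ Finset.range n, (V.nbrs v).card = S3 at *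
    obtain ⟨q1, qb, -, qab, qbb⟩ := packing_products_le a1 b1
    calc n * b + (b * S1 + (b * (a * (n * b)) + b * (n * a))) + (b * S2 + b * S3) + n * b + n + n
        ≤ N * b + (b * (N * b) + (b * (a * (N * b)) + b * (N * a))) +
            (b * (a * (N * b)) + b * (N * a)) + N * b + N + N := by
          gcongr
          exact e3.trans (Nat.mul_le_mul_right _ e4)
      _ = 2 * (N * b) + N * (b * b) + 2 * (N * (a * b ^ 2)) + 2 * (N * (a * b)) + 2 * (N * 1) := by
          ring
      _ ≤ 9 * (N * (a * b ^ 2)) := by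
          have := Nat.mul_le_mul_left N q1
          have := Nat.mul_le_mul_left N qb
          have := Nat.mul_le_mul_left N qab
          have := Nat.mul_le_mul_left N qbb
          omega

/-! ### Neighbors of the new nodes, and copies of the parent data -/

/-- The local search misses nothing: each node is within `2ρ` of its parent, so nodes at distance at
most `E` have parents at distance at most `E + 4ρ ≤ D`. -/
theorem setNbrs_meets {ρ D E : ℝ} {V : Level d N} {s : State d N}
    (h : Refines x ρ V s) (hV : V.Good x (2 * ρ) D)
    (hρ : 0 < ρ) (hE : E + 4 * ρ ≤ D) (hD' : D ≤ 16 * ρ) :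
    Meets (setNbrs E s) (s.cur.size * (ballPacking d 4 * (ballPacking d 1 + 1) + 1)) fun s' =>
      ∃ nb : ℕ → Finset ℕ, s' = { s with cur := { s.cur with nbrs := nb } } ∧
        ∀ v < s.cur.size, ∀ w, w ∈ nb v ↔
          w < s.cur.size ∧ ‖s.cur.loc w - s.cur.loc v‖ ≤ E := by
  refine (Meets.forEach_range (fun done s' => ∃ nb : ℕ → Finset ℕ,
    s' = { s with cur := { s.cur with nbrs := nb } } ∧ ∀ v ∈ done, ∀ w, w ∈ nb v ↔
      w < s.cur.size ∧ ‖s.cur.loc w - s.cur.loc v‖ ≤ E)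
    (fun _ => ballPacking d 4 * (ballPacking d 1 + 1)) ⟨s.cur.nbrs, rfl, by simp⟩ ?_).mono
    (by simp) (by simp)
  rintro done v hv _ ⟨nb, rfl, hnb⟩
  have hp := h.parent_lt v hv
  dsimp only
  rw [h.nbrs_eq]
  refine (Meets.bind (l := 0) (Meets.forEach_finset (fun done (S : Finset ℕ) => ∀ w, w ∈ S ↔
    (∃ r ∈ done, w ∈ s.par.children r) ∧ ‖s.cur.loc w - s.cur.loc v‖ ≤ E)
    (fun r => (s.par.children r).card) (by simp) fun done r _ S hS => ?_)
    fun S hS => Meets.pure ⟨Function.update nb v S, rfl, ?_⟩).mono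
    (h.sum_card_children_le hV hρ hD' hp) fun _ h => h
  · refine (Meets.forEach_finset (fun done' (S : Finset ℕ) => ∀ w, w ∈ S ↔
      ((∃ r ∈ done, w ∈ s.par.children r) ∨ w ∈ done') ∧ ‖s.cur.loc w - s.cur.loc v‖ ≤ E)
      (fun _ => 0) (by simpa using hS) fun done' c _ S hS => ?_).mono (by simp) ?_
    · split_ifs with hc <;> refine Meets.pure fun w => ?_
      · rw [Finset.mem_insert, hS]
        by_cases hw : w = c
        · subst hw
          simp [hc]
        · simp [hw]
      · rw [hS]
        by_cases hw : w = c
        · subst hw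
          simp [hc]
        · simp [hw]
    · intro S hS w
      rw [hS]
      simp [or_and_right, exists_or]
  · intro u hu w
    by_cases huv : u = v
    · subst huv
      rw [Function.update_self, hS]
      simp only [Finset.mem_toList, h.mem_children]
      constructor
      · rintro ⟨⟨r, -, hw, -⟩, hE⟩
        exact ⟨hw, hE⟩
      · rintro ⟨hw, hwE⟩
        refine ⟨⟨_, (hV.mem_nbrs _ hp _).2 ⟨h.parent_lt w hw, ?_⟩, hw, rfl⟩, hwE⟩
        have h1 := h.near_parent w hw
        have h2 := h.near_parent u hv
        have e : V.loc (s.cur.parent w) - V.loc (s.cur.parent u) =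
            (s.cur.loc w - s.cur.loc u) - (s.cur.loc w - V.loc (s.cur.parent w)) +
              (s.cur.loc u - V.loc (s.cur.parent u)) := by abel
        rw [e]
        refine (norm_add_le _ _).trans ?_
        linarith [norm_sub_le (s.cur.loc w - s.cur.loc u)
          (s.cur.loc w - V.loc (s.cur.parent w))]
    · rw [Function.update_of_ne huv]
      refine hnb u ?_ w
      simpa [huv] using hu

theorem copyData_meets {ρ D : ℝ} {V : Level d N} {s : State d N} (hs : s.par = V)
    (hV : V.Good x (2 * ρ) D) (hρ : 0 < ρ) :
    Meets (copyData s) (N * ballPacking d 1 + 2 * N) fun A => ∀ r < V.size, A r = V.data r := by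
  subst hs
  refine (Meets.forEach_range (fun done A => ∀ r ∈ done, A r = s.par.data r)
    (fun r => (s.par.data r).card + 1) (by simp) fun done r _ A hA => Meets.tick_bind ?_).mono ?_
    (by simp)
  · refine (Meets.bind (l := 0) (Meets.forEach_finset (fun done (B : Finset (Fin N)) =>
      ∀ i, i ∈ B ↔ i ∈ done) (fun _ => 0) (by simp) fun done i _ B hB =>
        Meets.pure fun j => by simp [hB, or_comm]) fun B hB => Meets.pure fun q hq => ?_).mono
          (by simp) fun _ h => h
    by_cases hqr : q = r
    · subst hqr
      rw [Function.update_self]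
      ext i
      simp [hB]
    · rw [Function.update_of_ne hqr]
      exact hA q (by simpa [hqr] using hq)
  · have e1 := hV.sum_card_data_le (by positivity)
    have e2 := hV.size_le
    simp only [Finset.sum_add_distrib, Finset.sum_const, Finset.card_range, smul_eq_mul, mul_one]
    omega

/-! ### Voronoi repartitioning -/

/-- Grouping the nodes by parent counts each parent at most `P_1` times. -/
theorem Refines.sum_parent_le {ρ : ℝ} {V : Level d N} {s : State d N} (h : Refines x ρ V s)
    (hρ : 0 < ρ) (F : ℕ → ℕ) : ∑ c ∈ Finset.range s.cur.size, F (s.cur.parent c) ≤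
      ballPacking d 1 * ∑ p ∈ Finset.range V.size, F p := by
  rw [← Finset.sum_fiberwise_of_maps_to (g := s.cur.parent) (t := Finset.range V.size)
    fun c hc => Finset.mem_range.2 (h.parent_lt c (Finset.mem_range.1 hc)), Finset.mul_sum]
  refine Finset.sum_le_sum fun p _ => ?_
  have e : (Finset.range s.cur.size).filter (fun c => s.cur.parent c = p) =
      s.par.children p := by
    ext c
    simp [h.mem_children]
  rw [e, Finset.sum_congr rfl (g := fun _ => F p) fun c hc => by
    rw [((h.mem_children p c).1 hc).2], Finset.sum_const, smul_eq_mul]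
  exact Nat.mul_le_mul_right _ (h.card_children_le hρ p)

/-- The value `m` is at most `ρ` and at least the distance from datum `i` to a node to which the
repartitioning may assign it. -/
def Attained (x : Fin N → EuclideanSpace ℝ (Fin d)) (ρ : ℝ) (V : Level d N) (s : State d N)
    (i : Fin N) (m : ENNReal) : Prop :=
  m ≤ ENNReal.ofReal ρ ∧ ∃ v < s.cur.size, (∃ r ∈ V.nbrs (s.cur.parent v), i ∈ V.data r) ∧
    ENNReal.ofReal ‖x i - s.cur.loc v‖ ≤ m

/-- The node that received the datum during creation is a child of a neighbor of its old holder, by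
symmetry of the neighbor relation. The search thus meets a node within `ρ`, and the minimum is
finite and attained. That the minimum is global is not needed. -/
theorem nearest_meets {ρ D : ℝ} {V : Level d N} {s : State d N} {A : ℕ → Finset (Fin N)}
    (h : Refines x ρ V s) (hV : V.Good x (2 * ρ) D) (hρ : 0 < ρ) (hD' : D ≤ 16 * ρ)
    (hA : ∀ r < V.size, A r = V.data r) (hempty : ∀ r < V.size, s.par.data r = ∅) :
    Meets (nearest x A s)
      (N * ballPacking d 1 * (ballPacking d 4 * (ballPacking d 1 + 1) + 1) + N)
      fun near => ∀ i, Attained x ρ V s i (near i) := by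
  rw [nearest, h.size_eq, h.nbrs_eq]
  refine (Meets.forEach_range (fun done (near : Fin N → ENNReal) =>
    ∀ r ∈ done, ∀ i ∈ V.data r, Attained x ρ V s i (near i))
    (fun r => (V.data r).card * (ballPacking d 4 * (ballPacking d 1 + 1) + 1)) (by simp)
    fun done r hr near hnear => ?_).mono ?_ ?_
  · rw [hA r hr]
    refine (Meets.forEach_finset (fun done' (near : Fin N → ENNReal) =>
      (∀ r ∈ done, ∀ i ∈ V.data r, Attained x ρ V s i (near i)) ∧
        ∀ i ∈ done', Attained x ρ V s i (near i))
      (fun _ => ballPacking d 4 * (ballPacking d 1 + 1)) (by simpa using hnear)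
      fun done' i hi near hnear => ?_).mono (by simp) ?_
    · refine (Meets.bind (l := 0) (Meets.forEach_finset (fun qs (m : ENNReal) =>
        (m = ⊤ ∨ ∃ q ∈ V.nbrs r, ∃ c ∈ s.par.children q,
          m = ENNReal.ofReal ‖x i - s.cur.loc c‖) ∧
        ∀ q ∈ qs, ∀ c ∈ s.par.children q, m ≤ ENNReal.ofReal ‖x i - s.cur.loc c‖)
        (fun q => (s.par.children q).card) (by simp) fun qs q hq m hm => ?_) fun m hm => ?_).mono
        (h.sum_card_children_le hV hρ hD' hr) fun _ h => h
      · refine (Meets.forEach_finset (fun cs (m : ENNReal) =>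
          (m = ⊤ ∨ ∃ q ∈ V.nbrs r, ∃ c ∈ s.par.children q,
            m = ENNReal.ofReal ‖x i - s.cur.loc c‖) ∧
          (∀ q ∈ qs, ∀ c ∈ s.par.children q, m ≤ ENNReal.ofReal ‖x i - s.cur.loc c‖) ∧
          ∀ c ∈ cs, m ≤ ENNReal.ofReal ‖x i - s.cur.loc c‖) (fun _ => 0) (by simpa using hm)
          fun cs c hc m hm => Meets.pure ⟨?_, fun q hq c hc =>
            min_le_of_left_le (hm.2.1 q hq c hc), ?_⟩).mono (by simp) ?_
        · rcases min_choice m (ENNReal.ofReal ‖x i - s.cur.loc c‖) with e | e <;> rw [e]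
          exacts [hm.1, Or.inr ⟨q, hq, c, hc, rfl⟩]
        · simp only [List.mem_append, List.mem_singleton]
          rintro c' (hc' | rfl)
          exacts [min_le_of_left_le (hm.2.2 c' hc'), min_le_right _ _]
        · simp only [List.mem_append, List.mem_singleton, Finset.mem_toList]
          rintro m ⟨h1, h2, h3⟩
          refine ⟨h1, ?_⟩
          rintro q' (hq' | rfl)
          exacts [h2 q' hq', h3]
      · have key : Attained x ρ V s i m := by
          have hle : m ≤ ENNReal.ofReal ρ := by
            rcases h.assigned r hr i hi with hi' | ⟨c, hc, hic, hrc⟩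
            · simp [hempty r hr] at hi'
            · refine (hm.2 (s.cur.parent c) (Finset.mem_toList.2
                (hV.nbrs_comm (h.parent_lt c hc) hrc)) c ((h.mem_children _ c).2
                  ⟨hc, rfl⟩)).trans ?_
              exact ENNReal.ofReal_le_ofReal (h.data_near c i hic).2
          refine ⟨hle, ?_⟩
          rcases hm.1 with rfl | ⟨q, hq, c, hc, rfl⟩
          · exact absurd hle (by simp)
          · obtain ⟨hc', rfl⟩ := (h.mem_children _ c).1 hc
            exact ⟨c, hc', ⟨r, hV.nbrs_comm hr hq, hi⟩, le_rfl⟩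
        -- A datum held by several nodes has its entry overwritten; `Attained` holds whichever
        -- holder came last.
        have upd : ∀ j, Attained x ρ V s j (near j) ∨ j = i →
            Attained x ρ V s j (Function.update near i m j) := by
          intro j hj
          by_cases hji : j = i
          · subst hji
            rwa [Function.update_self]
          · rw [Function.update_of_ne hji]
            exact hj.resolve_right hji
        refine Meets.pure ⟨fun q hq j hj => upd j (Or.inl (hnear.1 q hq j hj)), fun j hj => ?_⟩
        rcases List.mem_append.1 hj with hj | hj
        exacts [upd j (Or.inl (hnear.2 j hj)), upd j (Or.inr (List.mem_singleton.1 hj))]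
    · simp only [List.mem_append, List.mem_singleton, Finset.mem_toList]
      rintro near' ⟨h1, h2⟩ q (hq | rfl)
      exacts [h1 q hq, h2]
  · have e1 := hV.sum_card_data_le (by positivity)
    rw [Finset.sum_add_distrib, ← Finset.sum_mul, Finset.sum_const, Finset.card_range,
      smul_eq_mul, mul_one]
    exact Nat.add_le_add (Nat.mul_le_mul_right _ e1) hV.size_le
  · intro near hnear i
    obtain ⟨r, hr, hi⟩ := hV.cover i
    exact hnear r (List.mem_range.2 hr) i hi

theorem voronoiStep_meets {ρ D : ℝ} {V : Level d N} {s : State d N} {A : ℕ → Finset (Fin N)}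
    (h : Refines x ρ V s) (hV : V.Good x (2 * ρ) D) (hρ : 0 < ρ) (hD' : D ≤ 16 * ρ)
    (hA : ∀ r < V.size, A r = V.data r)
    {nb : ℕ → Finset ℕ} (hempty : ∀ r < V.size, s.par.data r = ∅) (hsize : s.cur.size ≤ N) :
    Meets (voronoiStep x A { s with cur := { s.cur with nbrs := nb } })
      (7 * (N * (ballPacking d 4 * ballPacking d 1 ^ 2))) fun s' => ∃ dc : ℕ → Finset (Fin N),
        s' = { s with cur := { s.cur with nbrs := nb, data := dc } } ∧
        (∀ v < s.cur.size, ∀ i ∈ dc v, ‖x i - s.cur.loc v‖ ≤ ρ) ∧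
        ∀ i, ∃ v < s.cur.size, i ∈ dc v := by
  have h' : Refines x ρ V { s with cur := { s.cur with nbrs := nb } } := { h with }
  refine (Meets.bind (nearest_meets h' hV hρ hD' hA hempty) fun near hnear =>
    (Meets.forEach_range (fun done s' => ∃ dc : ℕ → Finset (Fin N),
      s' = { s with cur := { s.cur with nbrs := nb, data := dc } } ∧
      ∀ v ∈ done, ∀ i, i ∈ dc v ↔ (∃ r ∈ V.nbrs (s.cur.parent v), i ∈ V.data r) ∧
        ENNReal.ofReal ‖x i - s.cur.loc v‖ ≤ near i)
      (fun v => ∑ r ∈ V.nbrs (s.cur.parent v), ((V.data r).card + 1))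
      ⟨s.cur.data, rfl, by simp⟩ ?_).mono le_rfl ?_).mono ?_ fun _ h => h
  · rintro done v hv _ ⟨dc, rfl, hdc⟩
    dsimp only at hv ⊢
    rw [h.nbrs_eq]
    refine (Meets.bind (l := 0) (Meets.forEach_finset (fun done (B : Finset (Fin N)) =>
      ∀ i, i ∈ B ↔ (∃ r ∈ done, i ∈ V.data r) ∧
        ENNReal.ofReal ‖x i - s.cur.loc v‖ ≤ near i)
      (fun r => (V.data r).card) (by simp) fun done r hr B hB => ?_)
      fun B hB => Meets.pure ⟨Function.update dc v B, rfl, ?_⟩).mono le_rfl fun _ h => h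
    · rw [hA r ((hV.mem_nbrs _ (h.parent_lt v hv) r).1 hr).1]
      refine (Meets.forEach_finset (fun done' (B : Finset (Fin N)) =>
        ∀ i, i ∈ B ↔ ((∃ r ∈ done, i ∈ V.data r) ∨ i ∈ done') ∧
          ENNReal.ofReal ‖x i - s.cur.loc v‖ ≤ near i)
        (fun _ => 0) (by simpa using hB) fun done' j _ B hB => ?_).mono (by simp) ?_
      · split_ifs with hc <;> refine Meets.pure fun i => ?_
        · rw [Finset.mem_insert, hB]
          by_cases hij : i = j
          · subst hij
            simp only [hc, List.mem_append, List.mem_singleton, true_or, or_true, and_true]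
          · simp [hij]
        · rw [hB]
          by_cases hij : i = j
          · subst hij
            simp only [hc, and_false]
          · simp [hij]
      · intro B hB i
        rw [hB]
        simp [or_and_right, exists_or]
    · intro u hu i
      by_cases huv : u = v
      · subst huv
        rw [Function.update_self, hB]
        simp
      · rw [Function.update_of_ne huv]
        refine hdc u ?_ i
        simpa [huv] using hu
  · rintro _ ⟨dc, rfl, hdc⟩
    refine ⟨dc, rfl, fun v hv i hi => ?_, fun i => ?_⟩
    -- The threshold `near i` is at most `ρ`, which keeps assigned data near; it is attained at an
    -- eligible node, which keeps every datum assigned.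
    · have h1 := ((hdc v (List.mem_range.2 hv) i).1 hi).2.trans (hnear i).1
      exact (ENNReal.ofReal_le_ofReal_iff hρ.le).1 h1
    · obtain ⟨-, v, hv, hi, hle⟩ := hnear i
      exact ⟨v, hv, (hdc v (List.mem_range.2 hv) i).2 ⟨hi, hle⟩⟩
  · have hR : 0 < 2 * ρ := by positivity
    have e1 := hV.sum_nbrs_data_le hR (by linarith)
    have e2 : ∑ v ∈ Finset.range V.size, (V.nbrs v).card ≤ V.size * ballPacking d 4 := by
      refine (Finset.sum_le_card_nsmul _ _ (ballPacking d 4) fun v hv =>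
        hV.card_nbrs_le hR (by linarith) (Finset.mem_range.1 hv)).trans (by simp)
    have e3 := h.sum_parent_le hρ fun p => ∑ r ∈ V.nbrs p, ((V.data r).card + 1)
    have e4 := hV.size_le
    have a1 := one_le_ballPacking d (r := 4) (by norm_num)
    have b1 := one_le_ballPacking d (r := 1) (by norm_num)
    simp only [Finset.sum_add_distrib, Finset.sum_const,
      Finset.card_range, smul_eq_mul, mul_one] at e3 ⊢
    generalize ∑ v ∈ Finset.range s.cur.size, ∑ r ∈ V.nbrs (s.cur.parent v),
      (V.data r).card = T1 at *
    generalize ∑ v ∈ Finset.range s.cur.size, (V.nbrs (s.cur.parent v)).card = T2 at *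
    generalize ballPacking d 4 = a at *
    generalize ballPacking d 1 = b at *
    generalize V.size = n at *
    generalize ∑ v ∈ Finset.range n, ∑ r ∈ V.nbrs v, (V.data r).card = S2 at *
    generalize ∑ v ∈ Finset.range n, (V.nbrs v).card = S3 at *
    obtain ⟨q1, qb, -, qab, -⟩ := packing_products_le a1 b1
    have e5 : b * (S2 + S3) ≤ b * (a * (N * b) + N * a) :=
      Nat.mul_le_mul_left _ (Nat.add_le_add e1 (e2.trans (Nat.mul_le_mul_right _ e4)))
    calc N * b * (a * (b + 1) + 1) + N + (T1 + T2 + s.cur.size)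
        ≤ N * b * (a * (b + 1) + 1) + N + (b * (a * (N * b) + N * a) + N) := by
          have := e3.trans e5
          omega
      _ = 2 * (N * (a * b ^ 2)) + 2 * (N * (a * b)) + N * b + 2 * (N * 1) := by ring
      _ ≤ 7 * (N * (a * b ^ 2)) := by
          have := Nat.mul_le_mul_left N q1
          have := Nat.mul_le_mul_left N qb
          have := Nat.mul_le_mul_left N qab
          omega

/-! ### Building a level -/

/-- The nodes of `W` are children of nodes of `V`, and `V` records them as children. -/
def Level.Linked (V W : Level d N) : Prop :=
  (∀ c < W.size, W.parent c < V.size) ∧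
    ∀ p c, c ∈ V.children p ↔ c < W.size ∧ W.parent c = p

theorem Refines.good {ρ D E : ℝ} {V : Level d N} {s : State d N} (h : Refines x ρ V s)
    (hV : V.Good x (2 * ρ) D) {nb : ℕ → Finset ℕ} {dc : ℕ → Finset (Fin N)}
    (hnb : ∀ v < s.cur.size, ∀ w, w ∈ nb v ↔
      w < s.cur.size ∧ ‖s.cur.loc w - s.cur.loc v‖ ≤ E)
    (hnear : ∀ v < s.cur.size, ∀ i ∈ dc v, ‖x i - s.cur.loc v‖ ≤ ρ)
    (hcover : ∀ i, ∃ v < s.cur.size, i ∈ dc v) :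
    Level.Good x ρ E { s.cur with nbrs := nb, data := dc } where
  size_pos := by
    obtain ⟨v, hv, -⟩ := hcover ⟨0, hV.size_pos.trans_le hV.size_le⟩
    exact (Nat.zero_le v).trans_lt hv
  size_le := by
    obtain ⟨A, hA, -⟩ := h.size_le
    exact hA.trans ((Finset.card_le_univ A).trans (by simp))
  separated := h.separated
  mem_nbrs := hnb
  near := hnear
  cover := hcover
  children_eq := h.children_eq

theorem buildLevel_meets {ε D : ℝ} {L ℓ : ℕ} {lloyd voronoi : Bool} {pick : Rule d N}
    {F : List (Level d N)} {V : Level d N} (hpick : pick.Valid)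
    (hV : V.Good x (2 * radius L ε ℓ) D) (hρ : 0 < radius L ε ℓ)
    (hE : nbrRadius L ε ℓ + 4 * radius L ε ℓ ≤ D) (hD : 5 * radius L ε ℓ ≤ D)
    (hD' : D ≤ 16 * radius L ε ℓ) :
    Meets (buildLevel x ε lloyd voronoi pick L ℓ (F, V))
      (23 * (N * (ballPacking d 4 * ballPacking d 1 ^ 2))) fun T' =>
      ∃ (ch : ℕ → Finset ℕ) (da : ℕ → Finset (Fin N)) (W : Level d N),
        T' = (F ++ [{ V with children := ch, data := da }], W) ∧
        W.Good x (radius L ε ℓ) (nbrRadius L ε ℓ) ∧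
        Level.Linked { V with children := ch, data := da } W := by
  have copy : Meets (if voronoi then copyData ⟨F, V, Level.empty d N⟩ else pure fun _ => ∅ :
      Prog (ℕ → Finset (Fin N))) (N * ballPacking d 1 + 2 * N) fun A =>
        voronoi = true → ∀ r < V.size, A r = V.data r := by
    split_ifs with hv
    · exact (copyData_meets rfl hV hρ).mono le_rfl fun A hA _ => hA
    · exact Meets.pure fun h => absurd h hv
  refine (Meets.tick_bind (Meets.bind copy fun A hA => Meets.bind
    (addChildren_meets hpick (Refines.start hV F) hV hρ hD hD') fun s hs => ?_)).mono
    (k := (N * ballPacking d 1 + 2 * N + (9 * (N * (ballPacking d 4 * ballPacking d 1 ^ 2)) +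
      (N * (ballPacking d 4 * (ballPacking d 1 + 1) + 1) +
        7 * (N * (ballPacking d 4 * ballPacking d 1 ^ 2))))) + 1) ?_ fun _ h => h
  · obtain ⟨h, hfin, hempty⟩ := hs
    have hpar : s.par = { V with children := s.par.children, data := s.par.data } := by
      rw [← h.size_eq, ← h.loc_eq, ← h.parent_eq, ← h.nbrs_eq]
    have hsize : s.cur.size ≤ N := by
      obtain ⟨A, hA, -⟩ := h.size_le
      exact hA.trans ((Finset.card_le_univ A).trans (by simp))
    refine (Meets.bind (setNbrs_meets h hV hρ hE hD') fun s' hs' =>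
      Meets.bind (k := 7 * (N * (ballPacking d 4 * ballPacking d 1 ^ 2))) (l := 0)
        (P := fun s'' => ∃ (nb : ℕ → Finset ℕ) (dc : ℕ → Finset (Fin N)),
          s'' = { s with cur := { s.cur with nbrs := nb, data := dc } } ∧
          Level.Good x (radius L ε ℓ) (nbrRadius L ε ℓ) { s.cur with nbrs := nb, data := dc })
        ?_ fun s'' hs'' => Meets.pure ?_).mono
        (Nat.add_le_add_right (Nat.mul_le_mul_right _ hsize) _) fun _ h => h
    · obtain ⟨nb, rfl, hnb⟩ := hs'
      split_ifs with hv
      · refine (voronoiStep_meets h hV hρ hD' (hA hv) hempty hsize).mono le_rfl ?_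
        rintro _ ⟨dc, rfl, hnear, hcover⟩
        exact ⟨nb, dc, rfl, h.good hV hnb hnear hcover⟩
      · refine Meets.pure ⟨nb, s.cur.data, rfl, h.good hV hnb
          (fun v _ i hi => (h.data_near v i hi).2) fun i => ?_⟩
        obtain ⟨r, hr, hi⟩ := hV.cover i
        rcases h.assigned r hr i hi with hi | ⟨c, hc, hic, -⟩
        · simp [hempty r hr] at hi
        · exact ⟨c, hc, hic⟩
    · obtain ⟨nb, dc, rfl, hgood⟩ := hs''
      refine ⟨s.par.children, s.par.data, _, ?_, hgood, h.parent_lt, h.mem_children⟩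
      rw [← hpar, hfin]
  · have a1 := one_le_ballPacking d (r := 4) (by norm_num)
    have b1 := one_le_ballPacking d (r := 1) (by norm_num)
    have hN : 0 < N := hV.size_pos.trans_le hV.size_le
    generalize ballPacking d 4 = a at *
    generalize ballPacking d 1 = b at *
    obtain ⟨q1, qb, qa, qab, -⟩ := packing_products_le a1 b1
    -- In units of `N * (a * b ^ 2)`: copying 3, creation 9, neighbors 3, Voronoi step 7, initial
    -- tick 1, in total 23.
    have e1 := Nat.mul_le_mul_left N q1
    have e2 := Nat.mul_le_mul_left N qb
    have e3 := Nat.mul_le_mul_left N qa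
    have e4 := Nat.mul_le_mul_left N qab
    have e5 : N * (a * (b + 1) + 1) = N * (a * b) + N * a + N := by ring
    omega

/-! ### The whole tree -/

theorem radius_eq (L : ℕ) (ε : ℝ) : ∀ ℓ ≤ L, radius L ε ℓ = 2 ^ (L - ℓ) * ε
  | 0, _ => rfl
  | ℓ + 1, h => by
    rw [radius, radius_eq L ε ℓ (by omega), show L - ℓ = L - (ℓ + 1) + 1 by omega, pow_succ]
    ring

theorem radius_pos (L : ℕ) {ε : ℝ} (hε : 0 < ε) : ∀ ℓ, 0 < radius L ε ℓ
  | 0 => by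
    rw [radius]
    positivity
  | ℓ + 1 => half_pos (radius_pos L hε ℓ)

/-- This recursion is what the factor `1 - 2^{-(K-ℓ)}` is designed for: the parent radius exceeds
the child radius by exactly the two displacements to the parents. -/
theorem nbrRadius_succ {L ℓ : ℕ} (ε : ℝ) (h : ℓ < L) :
    nbrRadius L ε (ℓ + 1) + 4 * radius L ε (ℓ + 1) = nbrRadius L ε ℓ := by
  rw [nbrRadius, nbrRadius, radius, show L + 1 - ℓ = L - ℓ + 1 by omega,
    show L + 1 - (ℓ + 1) = L - ℓ by omega, pow_succ]
  field_simp
  ring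

theorem le_nbrRadius {L ℓ : ℕ} {ε : ℝ} (hε : 0 < ε) (h : ℓ ≤ L) :
    2 * radius L ε ℓ ≤ nbrRadius L ε ℓ := by
  have h1 : (1 : ℝ) / 2 ^ (L + 1 - ℓ) ≤ 1 / 2 := by
    rw [show L + 1 - ℓ = L - ℓ + 1 by omega, pow_succ]
    have : (1 : ℝ) ≤ 2 ^ (L - ℓ) := one_le_pow₀ (by norm_num)
    gcongr
    linarith
  rw [nbrRadius]
  have := radius_pos L hε ℓ
  nlinarith

theorem nbrRadius_le (L ℓ : ℕ) {ε : ℝ} (hε : 0 < ε) : nbrRadius L ε ℓ ≤ 4 * radius L ε ℓ := by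
  rw [nbrRadius]
  have h1 : (0 : ℝ) ≤ 1 / 2 ^ (L + 1 - ℓ) := by positivity
  have := radius_pos L hε ℓ
  nlinarith

/-- The level is nonempty, has separation at least `R`, and resolves the data up to `R`. -/
def Level.Resolves (x : Fin N → EuclideanSpace ℝ (Fin d)) (R : ℝ) (V : Level d N) : Prop :=
  0 < V.size ∧ res x V.points ≤ ENNReal.ofReal R ∧ ENNReal.ofReal R ≤ sep V.points

theorem Level.Good.resolves {R D : ℝ} {V : Level d N} (hV : V.Good x R D) : V.Resolves x R := by
  refine ⟨hV.size_pos, iSup_le fun i => ?_, ?_⟩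
  · obtain ⟨v, hv, hi⟩ := hV.cover i
    exact (iInf_le _ (⟨v, hv⟩ : Fin V.size)).trans (ENNReal.ofReal_le_ofReal (hV.near v hv i hi))
  · refine le_iInf fun v => le_iInf fun w => le_iInf fun hvw => ENNReal.ofReal_le_ofReal ?_
    exact (hV.separated v v.2 w w.2 (Fin.val_ne_of_ne hvw)).le

/-- A list of consecutive levels starting with a root, level `ℓ` at radius `radius L ε ℓ`. -/
structure IsTower (x : Fin N → EuclideanSpace ℝ (Fin d)) (L : ℕ) (ε : ℝ)
    (T : List (Level d N)) : Prop where
  root : ∀ U : Level d N, T[0]? = some U → U.size = 1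
  resolves : ∀ (ℓ : ℕ) (U : Level d N), T[ℓ]? = some U → U.Resolves x (radius L ε ℓ)
  linked : ∀ (ℓ : ℕ) (U W : Level d N), T[ℓ]? = some U → T[ℓ + 1]? = some W → U.Linked W

/-- Building `W` changes only the children and data of `V`, whereas the resolution of `V` and its
link to the level above depend only on its size, locations and parents. -/
theorem IsTower.extend {L : ℕ} {ε : ℝ} {F : List (Level d N)} {V W : Level d N}
    (h : IsTower x L ε (F ++ [V])) {ch : ℕ → Finset ℕ} {da : ℕ → Finset (Fin N)}
    (hW : W.Resolves x (radius L ε (F.length + 1)))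
    (hVW : Level.Linked { V with children := ch, data := da } W) :
    IsTower x L ε (F ++ [{ V with children := ch, data := da }] ++ [W]) := by
  have get_lt : ∀ {A : List (Level d N)} {ℓ}, ℓ < F.length → (F ++ A)[ℓ]? = F[ℓ]? := fun hℓ =>
    List.getElem?_append_left hℓ
  have get_length : ∀ {A B : List (Level d N)} {U}, (A ++ U :: B)[A.length]? = some U := by simp
  have get_last : ∀ {A : Level d N}, (F ++ [A, W])[F.length + 1]? = some W := by simp
  have get_ge : ∀ {A : Level d N} {ℓ}, F.length + 1 < ℓ → (F ++ [A, W])[ℓ]? = none :=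
    fun hℓ => List.getElem?_eq_none (by simp; omega)
  rw [List.append_assoc, List.singleton_append]
  refine ⟨fun U hU => ?_, fun ℓ U hU => ?_, fun ℓ U U' hU hU' => ?_⟩
  · rcases Nat.eq_zero_or_pos F.length with h0 | h0
    · rw [← h0, get_length, Option.some_inj] at hU
      subst hU
      exact h.root V (by rw [← h0, get_length])
    · rw [get_lt h0] at hU
      exact h.root U (by rw [get_lt h0, hU])
  · rcases lt_trichotomy ℓ F.length with hℓ | rfl | hℓ
    · rw [get_lt hℓ] at hU
      exact h.resolves ℓ U (by rw [get_lt hℓ, hU])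
    · rw [get_length, Option.some_inj] at hU
      subst hU
      exact h.resolves F.length V get_length
    · rcases (Nat.succ_le_of_lt hℓ).eq_or_lt with rfl | hℓ
      · rw [Nat.succ_eq_add_one, get_last, Option.some_inj] at hU
        exact hU ▸ hW
      · rw [get_ge hℓ] at hU
        cases hU
  · rcases lt_trichotomy ℓ F.length with hℓ | rfl | hℓ
    · rw [get_lt hℓ] at hU
      rcases (Nat.succ_le_of_lt hℓ).eq_or_lt with hℓ' | hℓ'
      · rw [show ℓ + 1 = F.length from hℓ', get_length, Option.some_inj] at hU'
        subst hU'
        exact h.linked ℓ U V (by rw [get_lt hℓ, hU])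
          (by rw [show ℓ + 1 = F.length from hℓ', get_length])
      · rw [get_lt hℓ'] at hU'
        exact h.linked ℓ U U' (by rw [get_lt hℓ, hU]) (by rw [get_lt hℓ', hU'])
    · rw [get_length, Option.some_inj] at hU
      rw [get_last, Option.some_inj] at hU'
      exact hU' ▸ hU ▸ hVW
    · rw [get_ge (by omega)] at hU'
      cases hU'

theorem IsTower.isRootedTree {L : ℕ} {ε : ℝ} {T : List (Level d N)} (h : IsTower x L ε T)
    (hT : 0 < T.length) : IsRootedTree T where
  root := ⟨hT, h.root _ (List.getElem?_eq_getElem hT)⟩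
  nonempty ℓ hℓ := (h.resolves ℓ _ (List.getElem?_eq_getElem hℓ)).1
  parent_lt ℓ hℓ := (h.linked ℓ _ _ (List.getElem?_eq_getElem (by omega))
    (List.getElem?_eq_getElem hℓ)).1
  mem_children ℓ hℓ p _ := (h.linked ℓ _ _ (List.getElem?_eq_getElem (by omega))
    (List.getElem?_eq_getElem hℓ)).2 p

/-! ### Depth, the root and the total cost -/

theorem dMax_le_radius {D ε : ℝ} (hε : 0 < ε) (hD : 0 ≤ D) : D ≤ radius (depth D ε) ε 0 := by
  rw [radius]
  rcases hD.eq_or_lt with rfl | hD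
  · positivity
  · rw [← div_le_iff₀ hε, ← Real.rpow_natCast,
      ← Real.logb_le_iff_le_rpow one_lt_two (by positivity)]
    exact Nat.le_ceil _

theorem norm_sub_mean_le_dMax (i : Fin N) : ‖x i - mean x‖ ≤ dMax x :=
  le_ciSup (f := fun i => ‖x i - mean x‖) (Set.finite_range _).bddAbove i

theorem coverTree_meets (hN : 0 < N) {ε : ℝ} (hε : 0 < ε) (lloyd voronoi : Bool)
    {pick : Rule d N} (hpick : pick.Valid) :
    Meets (coverTree x ε lloyd voronoi pick)
      (24 * (N * (ballPacking d 4 * ballPacking d 1 ^ 2)) * (depth (dMax x) ε + 1))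
      fun T => T.length = depth (dMax x) ε + 1 ∧ IsTower x (depth (dMax x) ε) ε T := by
  set K := N * (ballPacking d 4 * ballPacking d 1 ^ 2) with hK
  have hNK : N ≤ K := Nat.le_mul_of_pos_right _ (packing_products_le
    (one_le_ballPacking d (by norm_num)) (one_le_ballPacking d (by norm_num))).1
  have : Nonempty (Fin N) := ⟨⟨0, hN⟩⟩
  have hsum : Meets (forEach (List.finRange N) (0 : EuclideanSpace ℝ (Fin d))
      fun t i => pure (t + x i)) N fun t => (N : ℝ)⁻¹ • t = mean x :=
    (Meets.forEach (fun done t => t = (done.map x).sum) (fun _ => 0) rfl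
      fun done i _ t ht => Meets.pure (by simp [ht])).mono (by simp)
      (by rintro t rfl; rw [mean, Fin.sum_univ_def])
  have hmax : Meets (forEach (List.finRange N) (0 : ℝ)
      fun m i => pure (max m ‖mean x - x i‖)) N fun m => m = dMax x := by
    refine (Meets.forEach (fun done m => m ≤ dMax x ∧ 0 ≤ m ∧ ∀ i ∈ done, ‖x i - mean x‖ ≤ m)
      (fun _ => 0) ⟨(norm_nonneg _).trans (norm_sub_mean_le_dMax ⟨0, hN⟩), le_rfl, by simp⟩
      fun done i _ m hm => Meets.pure ⟨?_, le_max_of_le_left hm.2.1, fun j hj => ?_⟩).mono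
      (by simp) fun m hm => ?_
    · rw [norm_sub_rev]
      exact max_le hm.1 (norm_sub_mean_le_dMax i)
    · rcases List.mem_append.1 hj with hj | hj
      · exact le_max_of_le_left (hm.2.2 j hj)
      · rw [List.mem_singleton.1 hj, norm_sub_rev]
        exact le_max_right _ _
    · exact le_antisymm hm.1 (ciSup_le fun i => hm.2.2 i (List.mem_finRange i))
  have hall : Meets (forEach (List.finRange N) (∅ : Finset (Fin N))
      fun A i => pure (insert i A)) N fun A => ∀ i, i ∈ A :=
    (Meets.forEach (fun done (A : Finset (Fin N)) => ∀ i ∈ done, i ∈ A) (fun _ => 0) (by simp)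
      fun done i _ A hA => Meets.pure fun j hj => by
        rcases List.mem_append.1 hj with hj | hj
        · exact Finset.mem_insert_of_mem (hA j hj)
        · simp [List.mem_singleton.1 hj]).mono (by simp)
      fun A hA i => hA i (List.mem_finRange i)
  refine (Meets.tick_bind (Meets.bind hsum fun t ht => ?_)).mono
    (k := N + (N + (N + (depth (dMax x) ε * (23 * K + 1) + 0))) + 1) ?_ fun _ h => h
  · dsimp only
    rw [ht]
    refine Meets.bind hmax fun m hm => Meets.bind hall fun A hA => ?_
    subst hm
    refine Meets.bind (Meets.forEach_range_index (fun k T => T.1.length = k ∧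
      T.2.Good x (radius (depth (dMax x) ε) ε k) (nbrRadius (depth (dMax x) ε) ε k) ∧
      IsTower x (depth (dMax x) ε) ε (T.1 ++ [T.2])) ?_ ?_) fun T hT => Meets.pure ?_
    · have hroot : Level.Good x (radius (depth (dMax x) ε) ε 0) (nbrRadius (depth (dMax x) ε) ε 0)
          (⟨1, fun _ => mean x, fun _ => 0, fun _ => ∅, Function.update (fun _ => ∅) 0 {0},
            Function.update (fun _ => ∅) 0 A⟩ : Level d N) := by
        have hpos := radius_pos (depth (dMax x) ε) hε 0
        have hnb := le_nbrRadius hε (Nat.zero_le (depth (dMax x) ε))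
        refine ⟨one_pos, hN, fun v hv w hw hvw => ?_, fun v hv w => ?_, fun v _ i _ => ?_,
          fun i => ⟨0, one_pos, by simp [hA i]⟩, rfl⟩
        · dsimp only at hv hw
          omega
        · dsimp only at hv ⊢
          obtain rfl : v = 0 := by omega
          have : 0 ≤ nbrRadius (depth (dMax x) ε) ε 0 := by linarith
          simp [this]
        · exact (norm_sub_mean_le_dMax i).trans (dMax_le_radius hε
            ((norm_nonneg _).trans (norm_sub_mean_le_dMax i)))
      refine ⟨rfl, hroot, ⟨?_, ?_, ?_⟩⟩
      · rintro U hU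
        simp at hU
        exact hU ▸ rfl
      · rintro (_ | ℓ) U hU
        · simp at hU
          exact hU ▸ hroot.resolves
        · simp at hU
      · rintro ℓ U W - hW
        simp at hW
    · rintro k hk ⟨F, V⟩ ⟨hF, hV, htower⟩
      dsimp only at hF hV htower
      have hρ := radius_pos (depth (dMax x) ε) hε (k + 1)
      have h2 : radius (depth (dMax x) ε) ε k = 2 * radius (depth (dMax x) ε) ε (k + 1) := by
        rw [radius]
        ring
      have hE := nbrRadius_succ ε hk
      have hle := nbrRadius_le (depth (dMax x) ε) k hε
      have hge := le_nbrRadius hε (Nat.succ_le_of_lt hk)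
      rw [h2] at hV hle
      -- With `ρ` the new radius, `hE` and `hge` give `D ≥ 2ρ + 4ρ`, and `hle` gives `D ≤ 8ρ`.
      refine (buildLevel_meets hpick hV hρ hE.le (by linarith) (by linarith)).mono le_rfl ?_
      rintro _ ⟨ch, da, W, rfl, hW, hlink⟩
      refine ⟨by simp [hF], hW, htower.extend ?_ hlink⟩
      rw [hF]
      exact hW.resolves
    · exact ⟨by simp [hT.1], hT.2.2⟩
  -- The tick per level raises 23 to 24; the extra summand `24 * K` pays for the `3 * N + 1` steps
  -- of the setup.
  · have h1 : depth (dMax x) ε * (23 * K + 1) ≤ depth (dMax x) ε * (24 * K) :=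
      Nat.mul_le_mul_left _ (by omega)
    have h2 : 24 * K * (depth (dMax x) ε + 1) = depth (dMax x) ε * (24 * K) + 24 * K := by ring
    omega

theorem depth_add_one_le {D ε : ℝ} :
    ((depth D ε + 1 : ℕ) : ℝ) ≤ 4 * max 1 (Real.log (D / ε)) := by
  have h1 := le_max_left 1 (Real.log (D / ε))
  have h2 := le_max_right 1 (Real.log (D / ε))
  have hl := Real.log_two_gt_d9
  push_cast
  rcases le_or_gt (Real.logb 2 (D / ε)) 0 with h | h
  · rw [depth, Nat.ceil_eq_zero.2 h]
    push_cast
    linarith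
  · have h3 := Nat.ceil_lt_add_one h.le
    -- Here `1 / log 2 < 2`; rounding up and the root level add at most `2`, hence the factor `4`.
    have h4 : Real.logb 2 (D / ε) ≤ 2 * max 1 (Real.log (D / ε)) := by
      rw [Real.logb, div_le_iff₀ (by linarith)]
      nlinarith
    rw [depth]
    linarith

end CoverTree

theorem mainTheorem1 :
    ∃ C : ℝ, 0 < C ∧
      ∀ (d N : ℕ) (_ : 0 < N) (x : Fin N → EuclideanSpace ℝ (Fin d)) (ε : ℝ) (_ : 0 < ε)
        (lloyd voronoi : Bool) (pick : CoverTree.Rule d N) (_ : pick.Valid),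
        ∃ (T : List (CoverTree.Level d N)) (steps : ℕ),
          (CoverTree.coverTree x ε lloyd voronoi pick).run 0 = some (T, steps) ∧
          CoverTree.IsRootedTree T ∧
          T.length = ⌈Real.logb 2 (CoverTree.dMax x / ε)⌉₊ + 1 ∧
          (steps : ℝ) ≤ C * (CoverTree.ballPacking d 4 * (CoverTree.ballPacking d 1 : ℝ) ^ 2
            * N * max 1 (Real.log (CoverTree.dMax x / ε))) ∧
          ∀ (ℓ : ℕ) (hℓ : ℓ < T.length),
            CoverTree.res x T[ℓ].points ≤
              ENNReal.ofReal (2 ^ (⌈Real.logb 2 (CoverTree.dMax x / ε)⌉₊ - ℓ) * ε) ∧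
            ENNReal.ofReal (2 ^ (⌈Real.logb 2 (CoverTree.dMax x / ε)⌉₊ - ℓ) * ε) ≤
              CoverTree.sep T[ℓ].points := by
  -- `96 = 24 * 4`: the cost per level times the factor in `depth_add_one_le`.
  refine ⟨96, by norm_num, fun d N hN x ε hε lloyd voronoi pick hpick => ?_⟩
  obtain ⟨T, steps, hrun, hsteps, hlen, htower⟩ :=
    CoverTree.coverTree_meets (x := x) hN hε lloyd voronoi hpick 0
  refine ⟨T, steps, hrun, htower.isRootedTree (by omega), hlen, ?_, fun ℓ hℓ => ?_⟩
  · have h1 : (steps : ℝ) ≤ 24 * (N * (CoverTree.ballPacking d 4 *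
        (CoverTree.ballPacking d 1 : ℝ) ^ 2)) *
          ((CoverTree.depth (CoverTree.dMax x) ε + 1 : ℕ) : ℝ) := by
      rw [zero_add] at hsteps
      exact_mod_cast hsteps
    refine h1.trans ((mul_le_mul_of_nonneg_left CoverTree.depth_add_one_le
      (by positivity)).trans (le_of_eq ?_))
    ring
  · have h := (htower.resolves ℓ _ (List.getElem?_eq_getElem hℓ)).2
    rw [CoverTree.radius_eq _ _ _ (by omega)] at h
    exact h
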